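/- Let $M$ be a smooth compact manifold of dimension $n$ with two smooth commuting vector fields $v=\operatorname{grad} f_v$, $w=\operatorname{grad} f_w$ (gradients for one Riemannian metric). Assume that the critical points (common zeros) are isolated and that near each of them there is a smooth chart in which $v$ and $w$ are linear diagonal vector fields, and that the critical edges (one-dimensional orbits of the pair $(v,w)$) are isolated. The direction of an oriented critical edge is the unit vector $(a,b)$ such that $bv-aw$ vanishes on the edge and $av+bw$ points along it. A frame is a cyclic sequence $p_1,\dots,p_m$ of critical points, consecutive ones being connected by critical edges whose directions are cyclically ordered and cut the plane into angles less than $\pi$; it projects under $(f_v,f_w)$ to a convex polygon. For a frame $f$ the expected dimension $\operatorname{edim}(f)$ of the space $M_f$ of leaves (two-dimensional orbits) with boundary $f$ is the invariant Euler characteristic of the normal bundle $N$ of such a leaf over its closure, regarded as a toric domain with its action of $\mathbb R^2$; it depends on the boundary $f$ only. Explicitly, $$\operatorname{edim}(f)=\sum_i\dim\Gamma(U_i,N)^{\mathbb R^2}-\sum_i\dim\Gamma(U_i\cap U_{i+1},N)^{\mathbb R^2}+\dim\Gamma(U,N)^{\mathbb R^2}.$$ Here $U_i\cong[0,\infty)^2$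 is the toric chart at $p_i$, whose coordinates run along the two edges of $f$ at $p_i$ and on which $\mathbb R^2$ acts by the characters given by the directions of these edges away from $p_i$; $U_i\cap U_{i+1}$ is the part around an open edge and $U\cong(0,\infty)^2$ the open part; on $U_i$ the bundle $N$ is the product bundle whose fiber is the representation $T_{p_i}M/T$, with $T$ spanned by the tangent lines of the two edges; and $\Gamma(\cdot)^{\mathbb R^2}$ denotes the invariant continuous sections. A subdivision of $f$ into $k$ frames is a net of frames $f_1,\dots,f_k$, glued along common critical edges (with opposite orientations) to each other and to the edges of $f$, such that the convex polygons of $f_1,\dots,f_k$ have disjoint interiors and union the polygon of $f$. Its internal edges are the critical edges of the net that are not edges of $f$. Its dual graph has the finite vertices $f_1,\dots,f_k$, a vertex at infinity, and an edge across every edge of the net, directed orthogonally to it; edges across the edges of $f$ go to infinity. The expected dimension of the space of realizations of a graph with directions is $2V-E-2$, where $V$ is the number of finite vertices and $E$ the number of edges between finite vertices. The expected codimension of the subdivision is $C=\operatorname{edim}(f)-\sum_{i=1}^k\operatorname{edim}(f_i)$. **Lemma (expected codimension formula).** For every subdivision of a frame $f$ into $k$ frames with $s$ internal edges, the expected codimension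 $C$ equals the expected dimension of the space of realizations of the dual graph, namely $$C=2k-s-2 .$$ -/

import Mathlib

open Set Filter Topology Manifold
open scoped ContDiff

/-- Coordinates on the plane `ℝ²` of pairs of coefficients of `(v, w)`; it also carries the
characters of the group `ℝ²` (through the standard pairing) and the projected frames. -/
abbrev Plane : Type := ℝ × ℝ

namespace Plane

/-- The standard pairing of two plane vectors. -/
def dot (a b : Plane) : ℝ := a.1 * b.1 + a.2 * b.2

/-- The oriented area spanned by two plane vectors. -/
def area (a b : Plane) : ℝ := a.1 * b.2 - a.2 * b.1

/-- Clockwise rotation by a right angle. It sends the direction of a side of a counterclockwise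
polygon to the outer normal of that side. -/
def rot (a : Plane) : Plane := (a.2, -a.1)

/-- The vectors `d i` span pairwise distinct rays, and these rays cut the plane into angles that
are all less than `π`; the last condition is expressed by saying that every open half-plane through
the origin contains one of the rays. -/
structure IsToricFan {ι : Type*} (d : ι → Plane) : Prop where
  ne_zero : ∀ i, d i ≠ 0
  distinct : ∀ i j, SameRay ℝ (d i) (d j) → i = j
  angles_lt : ∀ u : Plane, u ≠ 0 → ∃ i, 0 < dot u (d i)

/-- The vectors `d 0, d 1, …` follow each other counterclockwise: `d (i + 1)` comes after `d i` at
an angle in `(0, π)`, and no other vector of the family lies strictly between the two. -/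
def IsCyclicallyOrdered {m : ℕ} [NeZero m] (d : Fin m → Plane) : Prop :=
  ∀ i, 0 < area (d i) (d (i + 1)) ∧ ∀ j, ¬ (0 < area (d i) (d j) ∧ 0 < area (d j) (d (i + 1)))

theorem rot_neg (a : Plane) : rot (-a) = -rot a := by
  simp [rot]

theorem rot_zero : rot 0 = 0 := by
  simp [rot, Prod.ext_iff]

theorem rot_injective : Function.Injective rot := by
  intro a b h
  simp only [rot, Prod.mk.injEq, neg_inj] at h
  exact Prod.ext h.2 h.1

/-- Rotation by a right angle as a linear map. -/
def rotLin : Plane →ₗ[ℝ] Plane where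
  toFun := rot
  map_add' a b := by ext <;> simp [rot]; ring
  map_smul' c a := by ext <;> simp [rot]

theorem IsToricFan.neg {ι : Type*} {d : ι → Plane} (h : IsToricFan d) :
    IsToricFan (fun i => -d i) where
  ne_zero i := neg_ne_zero.2 (h.ne_zero i)
  distinct i j hij := h.distinct i j (sameRay_neg_iff.1 hij)
  angles_lt u hu := by
    obtain ⟨i, hi⟩ := h.angles_lt (-u) (neg_ne_zero.2 hu)
    refine ⟨i, ?_⟩
    simpa [dot] using hi

theorem IsToricFan.rot {ι : Type*} {d : ι → Plane} (h : IsToricFan d) :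
    IsToricFan (fun i => rot (d i)) where
  ne_zero i hi := h.ne_zero i (rot_injective (hi.trans rot_zero.symm))
  distinct i j hij := h.distinct i j
    ((rot_injective.sameRay_map_iff (f := rotLin)).1 hij)
  angles_lt u hu := by
    have hu' : -Plane.rot u ≠ 0 := fun h0 => hu
      (rot_injective ((neg_eq_zero.1 h0).trans rot_zero.symm))
    obtain ⟨i, hi⟩ := h.angles_lt (-Plane.rot u) hu'
    refine ⟨i, ?_⟩
    simp only [dot, Plane.rot, Prod.fst_neg, Prod.snd_neg] at hi ⊢
    linarith

theorem IsToricFan.comp_equiv {ι κ : Type*} {d : ι → Plane} (h : IsToricFan d) (e : κ ≃ ι) :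
    IsToricFan (fun i => d (e i)) where
  ne_zero i := h.ne_zero (e i)
  distinct i j hij := e.injective (h.distinct _ _ hij)
  angles_lt u hu := by
    obtain ⟨i, hi⟩ := h.angles_lt u hu
    exact ⟨e.symm i, by simpa using hi⟩

end Plane

/-- A graph with directions: finite vertices `V`, one more vertex `none` called infinity, and
oriented edges, each coming with its reversal. -/
structure GraphWithDirections where
  V : Type
  fintypeV : Fintype V
  Dart : Type
  fintypeDart : Fintype Dart
  src : Dart → Option V
  rev : Dart → Dart
  rev_rev : ∀ x, rev (rev x) = x
  dir : Dart → Plane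
  dir_rev : ∀ x, dir (rev x) = -dir x
  fan : ∀ o : Option V, Plane.IsToricFan (fun x : {x : Dart // src x = o} => dir x.1)

namespace GraphWithDirections

/-- The unoriented edges of the graph both of whose ends are finite vertices. -/
def internalEdges (G : GraphWithDirections) : Set (Sym2 G.Dart) :=
  {e | ∃ x, e = s(x, G.rev x) ∧ G.src x ≠ none ∧ G.src (G.rev x) ≠ none}

/-- The expected dimension of the space of realizations. -/
noncomputable def expectedDim (G : GraphWithDirections) : ℤ :=
  2 * (Nat.card G.V : ℤ) - (G.internalEdges.ncard : ℤ) - 2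

end GraphWithDirections

section ToricCharts

/-- The action of `t ∈ ℝ²` on the coordinates of a toric chart, by the characters `β₁` and `β₂`. -/
noncomputable def toricAct (β₁ β₂ t : Plane) (x : ℝ × ℝ) : ℝ × ℝ :=
  (Real.exp (Plane.dot β₁ t) * x.1, Real.exp (Plane.dot β₂ t) * x.2)

/-- The diagonal action of `t ∈ ℝ²` on `ℝⁿ` by the characters `α j`. -/
noncomputable def diagAct {n : ℕ} (α : Fin n → Plane) (t : Plane)
    (X : EuclideanSpace ℝ (Fin n)) : EuclideanSpace ℝ (Fin n) :=
  WithLp.toLp 2 fun j => Real.exp (Plane.dot (α j) t) * X j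

/-- Let `D ⊆ ℝ²` be an invariant part of a toric chart, acted on by the characters `β₁, β₂`, and
let the fiber `ℝⁿ ⧸ T` carry the action induced by the characters `α`. This is the space of
continuous sections `s` of the equivariant bundle `D × (ℝⁿ ⧸ T)` over `D` that are invariant,
i.e. satisfy `s (t • x) = t • s x`; the class of `diagAct α t X` is `t` applied to the class
of `X`. -/
def invariantSections {n : ℕ} (D : Set (ℝ × ℝ)) (β₁ β₂ : Plane) (α : Fin n → Plane)
    (T : Submodule ℝ (EuclideanSpace ℝ (Fin n))) :
    Submodule ℝ (D → EuclideanSpace ℝ (Fin n) ⧸ T) where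
  carrier := {s | Continuous s ∧ ∀ (t : Plane) (x y : D), (y : ℝ × ℝ) = toricAct β₁ β₂ t x →
    ∃ X, T.mkQ X = s x ∧ T.mkQ (diagAct α t X) = s y}
  zero_mem' := by
    refine ⟨continuous_const, fun t x y _ => ⟨0, by simp, ?_⟩⟩
    have : diagAct α t 0 = 0 := by ext j; simp [diagAct]
    simp [this]
  add_mem' := by
    rintro a b ⟨ha, ha'⟩ ⟨hb, hb'⟩
    refine ⟨ha.add hb, fun t x y h => ?_⟩
    obtain ⟨X, hX, hX'⟩ := ha' t x y h
    obtain ⟨Y, hY, hY'⟩ := hb' t x y h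
    refine ⟨X + Y, by rw [map_add, hX, hY]; rfl, ?_⟩
    have : diagAct α t (X + Y) = diagAct α t X + diagAct α t Y := by
      ext j; simp [diagAct, mul_add]
    rw [this, map_add, hX', hY']; rfl
  smul_mem' := by
    rintro c a ⟨ha, ha'⟩
    refine ⟨ha.const_smul c, fun t x y h => ?_⟩
    obtain ⟨X, hX, hX'⟩ := ha' t x y h
    refine ⟨c • X, by rw [map_smul, hX]; rfl, ?_⟩
    have : diagAct α t (c • X) = c • diagAct α t X := by
      ext j; simp [diagAct]; ring
    rw [this, map_smul, hX']; rfl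

end ToricCharts

section TwoMorse

variable {n : ℕ} {M : Type*} [TopologicalSpace M] [ChartedSpace (EuclideanSpace ℝ (Fin n)) M]
  [IsManifold (𝓡 n) ∞ M]

/-- `φ` is a smooth chart centered at `p` in which `v` and `w` are the linear diagonal vector
fields with eigenvalues `(α j).1` and `(α j).2`, for `j = 1, …, n`. -/
structure IsLinearization (v w : (x : M) → TangentSpace (𝓡 n) x) (p : M)
    (φ : OpenPartialHomeomorph M (EuclideanSpace ℝ (Fin n))) (α : Fin n → Plane) : Prop where
  mem_atlas : φ ∈ IsManifold.maximalAtlas (𝓡 n) ∞ M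
  mem_source : p ∈ φ.source
  map_center : φ p = 0
  linear_v : ∀ x ∈ φ.source,
    mfderiv (𝓡 n) (𝓡 n) φ x (v x) =
      (WithLp.toLp 2 fun j => (α j).1 * φ x j : EuclideanSpace ℝ (Fin n))
  linear_w : ∀ x ∈ φ.source,
    mfderiv (𝓡 n) (𝓡 n) φ x (w x) =
      (WithLp.toLp 2 fun j => (α j).2 * φ x j : EuclideanSpace ℝ (Fin n))

/-- `γ` parametrizes a one-dimensional orbit of the pair `(v, w)` with direction the unit vector
`d = (a, b)`: the field `b v - a w` vanishes on the orbit, and `γ` is a trajectory of the field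
`a v + b w`, which does not vanish on it. -/
structure IsEdgeCurve (v w : (x : M) → TangentSpace (𝓡 n) x) (d : Plane) (γ : ℝ → M) : Prop where
  unit : d.1 ^ 2 + d.2 ^ 2 = 1
  integral : IsMIntegralCurve (I := 𝓡 n) γ (fun x => d.1 • v x + d.2 • w x)
  vanish : ∀ t, d.2 • v (γ t) - d.1 • w (γ t) = 0
  moving : ∀ t, d.1 • v (γ t) + d.2 • w (γ t) ≠ 0

variable (n M) in
/-- A pair of smooth commuting vector fields on the manifold `M`, which are gradients of two
functions for one Riemannian metric, with isolated and diagonally linearizable critical points and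
with isolated critical edges. -/
structure TwoMorse where
  v : (x : M) → TangentSpace (𝓡 n) x
  w : (x : M) → TangentSpace (𝓡 n) x
  smooth_v : ContMDiff (𝓡 n) (𝓡 n).tangent ∞ (fun x => (⟨x, v x⟩ : TangentBundle (𝓡 n) M))
  smooth_w : ContMDiff (𝓡 n) (𝓡 n).tangent ∞ (fun x => (⟨x, w x⟩ : TangentBundle (𝓡 n) M))
  commute : ∀ x, VectorField.mlieBracket (𝓡 n) v w x = 0
  fv : M → ℝ
  fw : M → ℝ
  smooth_fv : ContMDiff (𝓡 n) 𝓘(ℝ, ℝ) ∞ fv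
  smooth_fw : ContMDiff (𝓡 n) 𝓘(ℝ, ℝ) ∞ fw
  metric : Bundle.ContMDiffRiemannianMetric (𝓡 n) ∞ (EuclideanSpace ℝ (Fin n))
    (fun x : M => TangentSpace (𝓡 n) x)
  gradient_v : ∀ (x : M) (X : TangentSpace (𝓡 n) x),
    mfderiv (𝓡 n) 𝓘(ℝ, ℝ) fv x X = metric.inner x (v x) X
  gradient_w : ∀ (x : M) (X : TangentSpace (𝓡 n) x),
    mfderiv (𝓡 n) 𝓘(ℝ, ℝ) fw x X = metric.inner x (w x) X
  critical_isolated : ∀ p, v p = 0 → w p = 0 → ∀ᶠ x in 𝓝[≠] p, ¬ (v x = 0 ∧ w x = 0)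
  exists_linearization : ∀ p, v p = 0 → w p = 0 → ∃ φ α, IsLinearization v w p φ α
  edges_isolated : ∀ d γ, IsEdgeCurve v w d γ → ∀ t, ∀ᶠ y in 𝓝 (γ t),
    Module.finrank ℝ (Submodule.span ℝ {v y, w y}) = 1 → y ∈ range γ

namespace TwoMorse

/-- The critical points: the common zeros of `v` and `w`. -/
abbrev CriticalPoint (D : TwoMorse n M) : Type _ := {p : M // D.v p = 0 ∧ D.w p = 0}

/-- A linearizing chart at a critical point. -/
noncomputable def linChart (D : TwoMorse n M) (p : D.CriticalPoint) :
    OpenPartialHomeomorph M (EuclideanSpace ℝ (Fin n)) :=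
  (D.exists_linearization p.1 p.2.1 p.2.2).choose

/-- The characters by which `ℝ²` acts on the tangent space at a critical point, in the coordinates
of the linearizing chart. -/
noncomputable def weight (D : TwoMorse n M) (p : D.CriticalPoint) : Fin n → Plane :=
  (D.exists_linearization p.1 p.2.1 p.2.2).choose_spec.choose

theorem isLinearization (D : TwoMorse n M) (p : D.CriticalPoint) :
    IsLinearization D.v D.w p.1 (D.linChart p) (D.weight p) :=
  (D.exists_linearization p.1 p.2.1 p.2.2).choose_spec.choose_spec

/-- The set `e` is a critical edge which, for the orientation given by the unit direction `d`,
goes from `p` to `q`. The end points do not belong to `e`. -/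
def IsEdge (D : TwoMorse n M) (e : Set M) (p q : D.CriticalPoint) (d : Plane) : Prop :=
  ∃ γ, IsEdgeCurve D.v D.w d γ ∧ range γ = e ∧
    Tendsto γ atBot (𝓝 p.1) ∧ Tendsto γ atTop (𝓝 q.1)

/-- The projection of `M` to the plane by the pair of functions. -/
def proj (D : TwoMorse n M) (x : M) : Plane := (D.fv x, D.fw x)

/-- The tangent line at the critical point `p` of a critical edge `e` that ends at `p`, in the
coordinates of the linearizing chart. -/
noncomputable def tangentLine (D : TwoMorse n M) (p : D.CriticalPoint) (e : Set M) :
    Submodule ℝ (EuclideanSpace ℝ (Fin n)) :=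
  Submodule.span ℝ (tangentConeAt ℝ (D.linChart p '' (e ∩ (D.linChart p).source)) 0)

/-- A frame: a cyclic sequence of critical points, the `i`-th one connected to the next one by a
critical edge, such that the directions of the edges are cyclically ordered (we list them
counterclockwise) and form a toric fan. Indices are taken cyclically; a frame has at least three
vertices, as has every toric fan. -/
structure Frame (D : TwoMorse n M) where
  size : ℕ
  vertex : Fin (size + 3) → D.CriticalPoint
  edge : Fin (size + 3) → Set M
  dir : Fin (size + 3) → Plane
  isEdge : ∀ i, D.IsEdge (edge i) (vertex i) (vertex (i + 1)) (dir i)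
  fan : Plane.IsToricFan dir
  cyclic : Plane.IsCyclicallyOrdered dir

namespace Frame

variable {D : TwoMorse n M}

/-- The convex polygon onto which a frame projects. -/
def polygon (f : D.Frame) : Set Plane := convexHull ℝ (range fun i => D.proj (f.vertex i).1)

/-- The tangent space of (the closure of) a leaf bounded by `f` at its `i`-th vertex: it is spanned
by the tangent lines of the two edges of `f` which meet there. The normal space is the quotient of
the tangent space of `M` by it. -/
noncomputable def leafTangent (f : D.Frame) (i : Fin (f.size + 3)) :
    Submodule ℝ (EuclideanSpace ℝ (Fin n)) :=
  D.tangentLine (f.vertex i) (f.edge i) ⊔ D.tangentLine (f.vertex i) (f.edge (i - 1))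

/-- The invariant sections of the normal bundle of a leaf bounded by `f`, over a part of the toric
chart `[0, ∞) × [0, ∞)` at the `i`-th vertex. The first coordinate of the chart runs along the edge
`i`, the second one along the edge `i - 1`, and `ℝ²` acts on them by the directions of these edges,
oriented away from the vertex. -/
noncomputable def normalSections (f : D.Frame) (i : Fin (f.size + 3)) (U : Set (ℝ × ℝ)) :
    Submodule ℝ (U → EuclideanSpace ℝ (Fin n) ⧸ f.leafTangent i) :=
  invariantSections U (f.dir i) (-f.dir (i - 1)) (D.weight (f.vertex i)) (f.leafTangent i)

/-- The expected dimension of the space of leaves bounded by `f`: the invariant Euler characteristic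
of the normal bundle, i.e. the Euler characteristic of the complex of invariant sections
`⨁ N(U_i) → ⨁ N(U_i ∩ U_{i+1}) → N(U)` over the charts `U_i` at the vertices, the neighbourhoods
`U_i ∩ U_{i+1}` of the open edges, and the open part `U` of the toric domain. -/
noncomputable def expectedDim (f : D.Frame) : ℤ :=
  ∑ i, (Module.finrank ℝ (f.normalSections i (Ici 0 ×ˢ Ici 0)) : ℤ)
    - ∑ i, (Module.finrank ℝ (f.normalSections i (Ioi 0 ×ˢ Ici 0)) : ℤ)
    + (Module.finrank ℝ (f.normalSections 0 (Ioi 0 ×ˢ Ioi 0)) : ℤ)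

end Frame

/-- The oriented sides of a net consisting of the frames `g i` inside of the frame `f`: the edges of
the frames `g i`, and the edges of `f`, which are seen from outside and hence taken with the opposite
orientation. -/
abbrev Side {D : TwoMorse n M} (f : D.Frame) {k : ℕ} (g : Fin k → D.Frame) : Type :=
  (Σ i, Fin ((g i).size + 3)) ⊕ Fin (f.size + 3)

namespace Side

variable {D : TwoMorse n M} {f : D.Frame} {k : ℕ} {g : Fin k → D.Frame}

/-- The critical edge underlying a side. -/
def carrier : Side f g → Set M
  | .inl x => (g x.1).edge x.2
  | .inr a => f.edge a

/-- The starting point of a side. -/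
def tail : Side f g → D.CriticalPoint
  | .inl x => (g x.1).vertex x.2
  | .inr a => f.vertex (a + 1)

/-- The end point of a side. -/
def head : Side f g → D.CriticalPoint
  | .inl x => (g x.1).vertex (x.2 + 1)
  | .inr a => f.vertex a

/-- The direction of a side. -/
def dir : Side f g → Plane
  | .inl x => (g x.1).dir x.2
  | .inr a => -f.dir a

/-- The frame in which a side lies; `none` stands for the outside of `f`. -/
def region : Side f g → Option (Fin k)
  | .inl x => some x.1
  | .inr _ => none

/-- The sides of the `i`-th frame. -/
def regionEquivSome (i : Fin k) :
    {x : Side f g // region x = some i} ≃ Fin ((g i).size + 3) where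
  toFun
    | ⟨.inl ⟨j, a⟩, h⟩ => (Option.some.inj h : j = i) ▸ a
    | ⟨.inr _, h⟩ => by cases h
  invFun a := ⟨.inl ⟨i, a⟩, rfl⟩
  left_inv := by
    rintro ⟨⟨j, a⟩ | a, h⟩
    · obtain rfl : j = i := Option.some.inj h
      rfl
    · cases h
  right_inv a := rfl

/-- The outer sides. -/
def regionEquivNone : {x : Side f g // region x = none} ≃ Fin (f.size + 3) where
  toFun
    | ⟨.inl _, h⟩ => by cases h
    | ⟨.inr a, _⟩ => a
  invFun a := ⟨.inr a, rfl⟩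
  left_inv := by
    rintro ⟨x | a, h⟩
    · cases h
    · rfl
  right_inv a := rfl

theorem fan (o : Option (Fin k)) :
    Plane.IsToricFan (fun x : {x : Side f g // region x = o} => Plane.rot (dir x.1)) := by
  cases o with
  | none =>
    convert (f.fan.neg.rot).comp_equiv (regionEquivNone (f := f) (g := g)) using 2 with x
    obtain ⟨x, rfl⟩ := (regionEquivNone (f := f) (g := g)).symm.surjective x
    simp only [Equiv.apply_symm_apply]
    rfl
  | some i =>
    convert ((g i).fan.rot).comp_equiv (regionEquivSome (f := f) (g := g) i) using 2 with x
    obtain ⟨x, rfl⟩ := (regionEquivSome (f := f) (g := g) i).symm.surjective x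
    simp only [Equiv.apply_symm_apply]
    rfl

end Side

/-- A subdivision of the frame `f` into `k` frames: a net of frames, in which every side is glued to
exactly one other side along the same critical edge with the opposite orientation, and which projects
to the plane as a subdivision of the convex polygon of `f` into convex polygons. -/
structure Subdivision {D : TwoMorse n M} (f : D.Frame) (k : ℕ) where
  piece : Fin k → D.Frame
  twin : Side f piece → Side f piece
  twin_twin : ∀ x, twin (twin x) = x
  carrier_twin : ∀ x, (twin x).carrier = x.carrier
  tail_twin : ∀ x, (twin x).tail = x.head
  head_twin : ∀ x, (twin x).head = x.tail
  dir_twin : ∀ x, (twin x).dir = -x.dir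
  outer_glued : ∀ a, (twin (.inr a)).region ≠ none
  union_polygon : ⋃ i, (piece i).polygon = f.polygon
  disjoint_interior : Pairwise fun i j =>
    Disjoint (interior (piece i).polygon) (interior (piece j).polygon)

namespace Subdivision

variable {D : TwoMorse n M} {f : D.Frame} {k : ℕ}

/-- The internal edges: the critical edges of the net that are not edges of `f`. -/
def internalEdges (S : Subdivision f k) : Set (Set M) :=
  {e | (∃ i a, (S.piece i).edge a = e) ∧ ∀ a, f.edge a ≠ e}

/-- The dual graph: its finite vertices are the frames of the subdivision, its edges cross the edges
of the net, with directions orthogonal to the directions of these, and the edges going to infinity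
cross the edges of `f`. -/
def dualGraph (S : Subdivision f k) : GraphWithDirections where
  V := Fin k
  fintypeV := inferInstance
  Dart := Side f S.piece
  fintypeDart := inferInstance
  src := Side.region
  rev := S.twin
  rev_rev := S.twin_twin
  dir x := Plane.rot x.dir
  dir_rev x := by rw [S.dir_twin, Plane.rot_neg]
  fan := Side.fan

/-- The expected codimension of the degeneration of leaves bounded by `f` into unions of leaves
bounded by the frames of the subdivision. -/
noncomputable def expectedCodim (S : Subdivision f k) : ℤ :=
  f.expectedDim - ∑ i, (S.piece i).expectedDim

end Subdivision

end TwoMorse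

end TwoMorse

/-! For a frame with `m` vertices, twice the expected dimension is `m - 4` plus a sum over the
oriented edges of terms that change sign when the edge is reversed. In a subdivision these terms
cancel across every internal edge, so `2C = (m - 4) - ∑ (m_i - 4)`. Since `∑ m_i - m = 2s`, this is
`2(2k - s - 2)`.

The formula for a single frame comes from counting characters of `ℝ²` at its vertices. An invariant
section over a toric chart is a sum of monomials, one for each normal character, and it extends over
a boundary edge when the corresponding exponent is positive. So sections over `U_i` count the
characters in the cone of the corner, and sections over `U_i ∩ U_{i+1}` the characters to the left
of the edge (`finrank_normalSections`). Exponents zero do not occur: as critical edges are isolated,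
exactly one character is parallel to an edge at its end (`IsEdge.exists_weight`), and it is tangent
to the leaf.

The indicator of a cone is a difference of two functions of its bounding rays, except for a
correction when the cone contains the cut of the argument (`indicator_inSector`). The number of such
corrections follows from the fact that a line through the origin meets all but two of the corner
cones (`sum_indicator_corner`).

The left counts are antisymmetrized by `IsEdge.leftCount_add`: at the two ends of an edge the
characters agree on the subgroup that fixes the edge, so the left counts for the two orientations
add up to `n - 1`. The reason is a Lax equation: the linearization of `b v - a w`, which vanishes on
the edge, has constant spectrum along it (`tracePow_edge_const`).

Altogether the constant is `n(m - 2) - m(n - 1) + 2(n - 2) = m - 4`. The projected polygons serve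
only to show that each internal edge carries exactly two sides of pieces and is not an edge of `f`.
-/

/-! ### Sectors of the plane and the rays they contain -/

namespace Plane

/-- The argument of a plane vector, in `(-π, π]`. -/
noncomputable def angle (a : Plane) : ℝ := Complex.arg ⟨a.1, a.2⟩

theorem exists_polar {a : Plane} (ha : a ≠ 0) :
    ∃ r > 0, a = (r * Real.cos (angle a), r * Real.sin (angle a)) := by
  have h0 : (⟨a.1, a.2⟩ : ℂ) ≠ 0 := by
    intro h
    apply ha
    have h1 := congrArg Complex.re h
    have h2 := congrArg Complex.im h
    exact Prod.ext h1 h2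
  refine ⟨‖(⟨a.1, a.2⟩ : ℂ)‖, norm_pos_iff.2 h0, ?_⟩
  rw [angle, Complex.norm_mul_cos_arg, Complex.norm_mul_sin_arg]

theorem angle_mem (a : Plane) : -Real.pi < angle a ∧ angle a ≤ Real.pi :=
  ⟨Complex.neg_pi_lt_arg _, Complex.arg_le_pi _⟩

theorem exists_area_eq {a b : Plane} (ha : a ≠ 0) (hb : b ≠ 0) :
    ∃ r > 0, area a b = r * Real.sin (angle b - angle a) := by
  obtain ⟨r, hr, h⟩ := exists_polar ha
  obtain ⟨s, hs, h'⟩ := exists_polar hb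
  refine ⟨r * s, mul_pos hr hs, ?_⟩
  rw [Real.sin_sub]
  have h1 := congrArg Prod.fst h
  have h2 := congrArg Prod.snd h
  have h3 := congrArg Prod.fst h'
  have h4 := congrArg Prod.snd h'
  simp only at h1 h2 h3 h4
  rw [area, h1, h2, h3, h4]
  ring

theorem sin_pos_iff_of_abs_lt {x : ℝ} (h1 : -(2 * Real.pi) < x) (h2 : x < 2 * Real.pi) :
    0 < Real.sin x ↔ (0 < x ∧ x < Real.pi) ∨ x < -Real.pi := by
  constructor
  · intro h
    by_contra hc
    push Not at hc
    rcases le_or_gt x 0 with h0 | h0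
    · exact absurd (Real.sin_nonpos_of_nonpos_of_neg_pi_le h0 hc.2) (not_le.2 h)
    · have h3 := Real.sin_nonneg_of_nonneg_of_le_pi (x := x - Real.pi)
        (by linarith [hc.1 h0]) (by linarith)
      rw [Real.sin_sub_pi] at h3
      linarith
  · rintro (⟨h3, h4⟩ | h3)
    · exact Real.sin_pos_of_pos_of_lt_pi h3 h4
    · have h4 := Real.sin_pos_of_pos_of_lt_pi (x := x + 2 * Real.pi) (by linarith) (by linarith)
      rwa [Real.sin_add_two_pi] at h4

theorem area_pos_iff {a b : Plane} (ha : a ≠ 0) (hb : b ≠ 0) :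
    0 < area a b ↔ (0 < angle b - angle a ∧ angle b - angle a < Real.pi) ∨
      angle b - angle a < -Real.pi := by
  obtain ⟨r, hr, h⟩ := exists_area_eq ha hb
  have := angle_mem a
  have := angle_mem b
  rw [h, mul_pos_iff_of_pos_left hr, sin_pos_iff_of_abs_lt (by linarith) (by linarith)]

theorem area_swap (a b : Plane) : area a b = -area b a := by
  simp only [area]; ring

theorem area_neg_right (a b : Plane) : area a (-b) = -area a b := by
  simp only [area, Prod.fst_neg, Prod.snd_neg]; ring

theorem area_neg_left (a b : Plane) : area (-a) b = -area a b := by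
  simp only [area, Prod.fst_neg, Prod.snd_neg]; ring

theorem area_smul_right (c : ℝ) (a b : Plane) : area a (c • b) = c * area a b := by
  simp only [area, Prod.smul_fst, Prod.smul_snd, smul_eq_mul]; ring

theorem area_smul_left (c : ℝ) (a b : Plane) : area (c • a) b = c * area a b := by
  simp only [area, Prod.smul_fst, Prod.smul_snd, smul_eq_mul]; ring

theorem area_add_right (a b c : Plane) : area a (b + c) = area a b + area a c := by
  simp only [area, Prod.fst_add, Prod.snd_add]; ring

theorem area_sub_right (a b c : Plane) : area a (b - c) = area a b - area a c := by
  simp only [area, Prod.fst_sub, Prod.snd_sub]; ring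

theorem area_self (a : Plane) : area a a = 0 := by
  simp only [area]; ring

theorem ne_zero_of_area_pos_left {a b : Plane} (h : 0 < area a b) : a ≠ 0 := by
  rintro rfl; simp [area] at h

theorem ne_zero_of_area_pos_right {a b : Plane} (h : 0 < area a b) : b ≠ 0 := by
  rintro rfl; simp [area] at h

theorem exists_smul_of_area_eq_zero {a b : Plane} (ha : a ≠ 0) (h : area a b = 0) :
    ∃ c : ℝ, b = c • a := by
  have h0 : 0 < a.1 ^ 2 + a.2 ^ 2 := by
    rcases eq_or_ne a.1 0 with h1 | h1
    · have h2 : a.2 ≠ 0 := fun h2 => ha (Prod.ext h1 h2)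
      positivity
    · positivity
  simp only [area] at h
  refine ⟨(a.1 * b.1 + a.2 * b.2) / (a.1 ^ 2 + a.2 ^ 2), Prod.ext ?_ ?_⟩
  · simp only [Prod.smul_fst, smul_eq_mul]
    field_simp
    linear_combination (-a.2) * h
  · simp only [Prod.smul_snd, smul_eq_mul]
    field_simp
    linear_combination a.1 * h

/-- The vector `u` lies in the cone spanned by `x` and `y`, the ray of `x` being included and the
ray of `y` excluded; this is meant for `0 < area x y`. -/
def InSector (x y u : Plane) : Prop := 0 ≤ area x u ∧ 0 < area u y

-- Up to a term independent of `u`, the indicator is the value of one function at `x` minus its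
-- value at `y`. The last term is the correction for a cone containing the cut of the argument. This
-- form makes sums over corners cancel along glued edges.
open Classical in
theorem indicator_inSector {x y u : Plane} (hxy : 0 < area x y) (hu : u ≠ 0) :
    (if InSector x y u then (1 : ℤ) else 0) = (if angle x ≤ angle u then 1 else 0)
      - (if angle y ≤ angle u then 1 else 0) + (if angle y < angle x then 1 else 0) := by
  have hx := ne_zero_of_area_pos_left hxy
  have hy := ne_zero_of_area_pos_right hxy
  have h1 : InSector x y u ↔ ¬ (0 < area u x) ∧ 0 < area u y := by
    rw [InSector, area_swap x u, not_lt, neg_nonneg]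
  rw [area_pos_iff hx hy] at hxy
  rw [area_pos_iff hu hx, area_pos_iff hu hy] at h1
  have := angle_mem x
  have := angle_mem y
  have := angle_mem u
  by_cases c1 : angle x ≤ angle u <;> by_cases c2 : angle y ≤ angle u <;>
    by_cases c3 : angle y < angle x <;> simp only [c1, c2, c3, if_true, if_false] <;>
    by_cases c4 : InSector x y u <;> simp only [c4, if_true, if_false] <;>
    norm_num <;> rw [h1] at c4 <;> grind

-- The four half-open sectors from `x` to `y`, `y` to `-x`, `-x` to `-y` and `-y` to `x` partition
-- the punctured plane.
open Classical in
theorem indicator_inSector_add_neg {x y u : Plane} (hxy : 0 < area x y) (hu : u ≠ 0) :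
    (if InSector y (-x) u then (1 : ℤ) else 0) + (if InSector y (-x) (-u) then 1 else 0) =
      1 - (if InSector x y u then 1 else 0) - (if InSector x y (-u) then 1 else 0) := by
  have hx := ne_zero_of_area_pos_left hxy
  simp only [InSector, area_neg_right, area_neg_left, area_swap y u, area_swap u x, neg_neg]
  rcases lt_trichotomy (area x u) 0 with h | h | h
  · by_cases c1 : 0 ≤ area u y <;> by_cases c2 : 0 < area u y <;> grind
  · obtain ⟨c, rfl⟩ := exists_smul_of_area_eq_zero hx h
    have hc : c ≠ 0 := by rintro rfl; simp at hu
    have hcy := area_smul_left c x y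
    rcases lt_or_gt_of_ne hc with hc | hc
    · have : c * area x y < 0 := mul_neg_of_neg_of_pos hc hxy
      grind
    · have : 0 < c * area x y := mul_pos hc hxy
      grind
  · by_cases c1 : 0 ≤ area u y <;> by_cases c2 : 0 < area u y <;> grind

variable {m : ℕ} [NeZero m] {d : Fin m → Plane}

/-- Every direction lies in exactly one of the sectors cut out by a cyclically ordered fan. -/
theorem existsUnique_inSector (hf : IsToricFan d) (hc : IsCyclicallyOrdered d) {w : Plane}
    (hw : w ≠ 0) : ∃! i, InSector (d i) (d (i + 1)) w := by
  classical
  have harea : ∀ i, 0 < area (d i) (d (i + 1)) := fun i => (hc i).1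
  -- a ray through `w` starts its own sector
  have hray : ∀ i, area (d i) w = 0 → 0 < dot (d i) w → InSector (d i) (d (i + 1)) w := by
    intro i h h'
    obtain ⟨c, rfl⟩ := exists_smul_of_area_eq_zero (hf.ne_zero i) h
    refine ⟨h.ge, ?_⟩
    rw [area_smul_left]
    refine mul_pos ?_ (harea i)
    by_contra hcon
    push Not at hcon
    simp only [dot, Prod.smul_fst, Prod.smul_snd, smul_eq_mul] at h'
    nlinarith [sq_nonneg (d i).1, sq_nonneg (d i).2]
  refine existsUnique_of_exists_of_unique ?_ ?_
  · by_cases hex : ∃ i, area (d i) w = 0 ∧ 0 < dot (d i) w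
    · obtain ⟨i, h, h'⟩ := hex
      exact ⟨i, hray i h h'⟩
    push Not at hex
    -- Pairing with `-rot (-w)` is `area · w`, so this gives a ray that has `w` on its left.
    obtain ⟨i₀, hi₀⟩ := hf.angles_lt (-rot (-w)) (by
      intro h
      rw [neg_eq_zero] at h
      exact hw (neg_eq_zero.1 (rot_injective (h.trans rot_zero.symm))))
    have hi₀ : 0 < area (d i₀) w := by
      simp only [dot, rot, area, Prod.fst_neg, Prod.snd_neg] at hi₀ ⊢; linarith
    -- choose the last ray before `w`
    obtain ⟨i, hi, hmax⟩ := Finset.exists_max_image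
      (Finset.univ.filter fun i => 0 < area (d i) w) (fun i => dot (d i) w / area (d i) w)
      ⟨i₀, by simpa using hi₀⟩
    simp only [Finset.mem_filter, Finset.mem_univ, true_and] at hi hmax
    refine ⟨i, hi.le, ?_⟩
    have hw0 : 0 < w.1 ^ 2 + w.2 ^ 2 := by
      rcases eq_or_ne w.1 0 with h1 | h1
      · have h2 : w.2 ≠ 0 := fun h2 => hw (Prod.ext h1 h2)
        positivity
      · positivity
    -- The quotient `dot / area` is the cotangent of the angle up to `w`; maximizing it selects the
    -- ray closest to `w`. This identity compares two such cotangents.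
    have key : ∀ j, (dot (d i) w * area (d j) w - dot (d j) w * area (d i) w) =
        -(area (d i) (d j)) * (w.1 ^ 2 + w.2 ^ 2) := by
      intro j; simp only [dot, area]; ring
    by_contra hcon
    push Not at hcon
    rcases hcon.lt_or_eq with h | h
    · have h1 : 0 < area (d (i + 1)) w := by rw [area_swap]; linarith
      have h2 := hmax _ h1
      rw [div_le_div_iff₀ h1 hi] at h2
      have h3 := key (i + 1)
      nlinarith [mul_pos (harea i) hw0]
    · have h1 : area (d (i + 1)) w = 0 := by rw [area_swap, h, neg_zero]
      have h2 := hex _ h1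
      have h3 := key (i + 1)
      have h4 : dot (d (i + 1)) w * area (d i) w ≤ 0 := mul_nonpos_of_nonpos_of_nonneg h2 hi.le
      rw [h1] at h3
      nlinarith [mul_pos (harea i) hw0]
  · -- two different sectors are disjoint
    have aux : ∀ i j, InSector (d i) (d (i + 1)) w → InSector (d j) (d (j + 1)) w →
        0 ≤ area (d i) (d j) → i = j := by
      intro i j hi hj hij
      rcases hij.lt_or_eq with h | h
      · refine absurd ⟨h, ?_⟩ ((hc i).2 j)
        rcases hj.1.lt_or_eq with h1 | h1
        · by_contra hcon
          push Not at hcon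
          -- Plücker relation for the four vectors; its right side is positive.
          have h2 : area (d i) w * area (d j) (d (i + 1)) =
            area (d i) (d j) * area w (d (i + 1)) + area (d j) w * area (d i) (d (i + 1)) := by
            simp only [area]; ring
          nlinarith [mul_pos h hi.2, mul_pos h1 (harea i), mul_nonneg hi.1 (neg_nonneg.2 hcon)]
        · obtain ⟨c, rfl⟩ := exists_smul_of_area_eq_zero (hf.ne_zero j) h1.symm
          have h2 := hj.2
          rw [area_smul_left] at h2
          have hcp : 0 < c := by
            by_contra hcon
            push Not at hcon
            nlinarith [harea j]
          have h3 := hi.2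
          rw [area_smul_left] at h3
          exact (mul_pos_iff_of_pos_left hcp).1 h3
      · apply hf.distinct
        obtain ⟨c, hcj⟩ := exists_smul_of_area_eq_zero (hf.ne_zero i) h.symm
        by_cases hcp : 0 ≤ c
        · rw [hcj]; exact SameRay.sameRay_nonneg_smul_right _ hcp
        push Not at hcp
        exfalso
        have h1 : area (d i) w = 0 := by
          have := hj.1
          rw [hcj, area_smul_left] at this
          refine le_antisymm ?_ hi.1
          by_contra hcon
          push Not at hcon
          nlinarith [mul_neg_of_neg_of_pos hcp hcon]
        obtain ⟨b, rfl⟩ := exists_smul_of_area_eq_zero (hf.ne_zero i) h1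
        have h2 := hi.2
        have h3 := hj.2
        have h4 := harea j
        rw [area_smul_left] at h2
        rw [hcj, area_smul_left] at h4
        rw [area_smul_left] at h3
        have hb : 0 < b := by
          by_contra hcon
          push Not at hcon
          nlinarith [harea i]
        have h5 := (mul_pos_iff_of_pos_left hb).1 h3
        nlinarith
    intro i j hi hj
    rcases le_total 0 (area (d i) (d j)) with h | h
    · exact aux i j hi hj h
    · exact (aux j i hj hi (by rw [area_swap]; linarith)).symm

open Classical in
theorem sum_indicator_inSector (hf : IsToricFan d) (hc : IsCyclicallyOrdered d) {w : Plane}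
    (hw : w ≠ 0) : ∑ i, (if InSector (d i) (d (i + 1)) w then (1 : ℤ) else 0) = 1 := by
  obtain ⟨i, hi, huniq⟩ := existsUnique_inSector hf hc hw
  rw [Finset.sum_eq_single i]
  · simp [hi]
  · intro j _ hj
    rw [if_neg (fun h => hj (huniq j h))]
  · simp

open Classical in
/-- A line through the origin meets all but two of the corners of a convex polygon. -/
theorem sum_indicator_corner (hf : IsToricFan d) (hc : IsCyclicallyOrdered d) {u : Plane}
    (hu : u ≠ 0) :
    ∑ i, ((if InSector (d i) (-d (i - 1)) u then (1 : ℤ) else 0) +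
      (if InSector (d i) (-d (i - 1)) (-u) then 1 else 0)) = m - 2 := by
  -- After the shift the corner runs from `d (i + 1)` to `-d i`, and the four-sector partition
  -- applies with `x = d i`, `y = d (i + 1)`.
  rw [← Equiv.sum_comp (Equiv.addRight (1 : Fin m))]
  simp only [Equiv.coe_addRight, add_sub_cancel_right]
  rw [Finset.sum_congr rfl fun i _ => indicator_inSector_add_neg (hc i).1 hu,
    Finset.sum_sub_distrib, Finset.sum_sub_distrib, sum_indicator_inSector hf hc hu,
    sum_indicator_inSector hf hc (neg_ne_zero.2 hu)]
  simp only [Finset.sum_const, Finset.card_univ, Fintype.card_fin, nsmul_eq_mul, mul_one]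
  ring

end Plane

/-! ### Vector fields in charts and their linearization at zeros -/

section ChartFields

theorem two_le_infty : (2 : WithTop ℕ∞) ≤ ∞ := by
  exact WithTop.coe_le_coe.2 le_top

variable {n : ℕ} {M : Type*} [TopologicalSpace M] [ChartedSpace (EuclideanSpace ℝ (Fin n)) M]
  [IsManifold (𝓡 n) ∞ M]

/-- The expression of the vector field `u` in the chart `φ`. -/
noncomputable def chartField (φ : OpenPartialHomeomorph M (EuclideanSpace ℝ (Fin n)))
    (u : (x : M) → TangentSpace (𝓡 n) x) : EuclideanSpace ℝ (Fin n) → EuclideanSpace ℝ (Fin n) :=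
  VectorField.mpullback (𝓡 n) (𝓡 n) φ.symm u

variable {φ ψ : OpenPartialHomeomorph M (EuclideanSpace ℝ (Fin n))}

omit [IsManifold (𝓡 n) ∞ M] in
theorem mdifferentiable_of_mem_maximalAtlas (hφ : φ ∈ IsManifold.maximalAtlas (𝓡 n) ∞ M) :
    φ.MDifferentiable (𝓡 n) (𝓡 n) :=
  ⟨(contMDiffOn_of_mem_maximalAtlas hφ).mdifferentiableOn (by simp),
    (contMDiffOn_symm_of_mem_maximalAtlas hφ).mdifferentiableOn (by simp)⟩

omit [IsManifold (𝓡 n) ∞ M] in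
theorem mfderiv_symm_isInvertible (hφ : φ ∈ IsManifold.maximalAtlas (𝓡 n) ∞ M)
    {y : EuclideanSpace ℝ (Fin n)} (hy : y ∈ φ.target) :
    (mfderiv (𝓡 n) (𝓡 n) φ.symm y).IsInvertible := by
  have h := mdifferentiable_of_mem_maximalAtlas hφ
  refine ContinuousLinearMap.IsInvertible.of_inverse (g := mfderiv (𝓡 n) (𝓡 n) φ (φ.symm y)) ?_ ?_
  · have := h.symm_comp_deriv (φ.map_target hy)
    rwa [φ.right_inv hy] at this
  · exact h.comp_symm_deriv hy

omit [IsManifold (𝓡 n) ∞ M] in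
theorem chartField_eq (hφ : φ ∈ IsManifold.maximalAtlas (𝓡 n) ∞ M)
    (u : (x : M) → TangentSpace (𝓡 n) x) {y : EuclideanSpace ℝ (Fin n)} (hy : y ∈ φ.target) :
    chartField φ u y = mfderiv (𝓡 n) (𝓡 n) φ (φ.symm y) (u (φ.symm y)) := by
  have h := mdifferentiable_of_mem_maximalAtlas hφ
  rw [chartField, VectorField.mpullback_apply]
  congr 1
  refine ContinuousLinearMap.inverse_eq ?_ ?_
  · have := h.symm_comp_deriv (φ.map_target hy)
    rwa [φ.right_inv hy] at this
  · exact h.comp_symm_deriv hy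

omit [IsManifold (𝓡 n) ∞ M] in
theorem chartField_apply (hφ : φ ∈ IsManifold.maximalAtlas (𝓡 n) ∞ M)
    (u : (x : M) → TangentSpace (𝓡 n) x) {x : M} (hx : x ∈ φ.source) :
    chartField φ u (φ x) = mfderiv (𝓡 n) (𝓡 n) φ x (u x) := by
  rw [chartField_eq hφ u (φ.map_source hx), φ.left_inv hx]

omit [IsManifold (𝓡 n) ∞ M] in
theorem mfderiv_chart_injective (hφ : φ ∈ IsManifold.maximalAtlas (𝓡 n) ∞ M) {x : M}
    (hx : x ∈ φ.source) : Function.Injective (mfderiv (𝓡 n) (𝓡 n) φ x) :=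
  (mdifferentiable_of_mem_maximalAtlas hφ).mfderiv_injective hx

theorem contDiffAt_chartField (hφ : φ ∈ IsManifold.maximalAtlas (𝓡 n) ∞ M)
    {u : (x : M) → TangentSpace (𝓡 n) x}
    (hu : ContMDiff (𝓡 n) (𝓡 n).tangent ∞ (fun x => (⟨x, u x⟩ : TangentBundle (𝓡 n) M)))
    {y : EuclideanSpace ℝ (Fin n)} (hy : y ∈ φ.target) : ContDiffAt ℝ ∞ (chartField φ u) y := by
  have : IsManifold (𝓡 n) 1 M := IsManifold.of_le (n := ∞) (by simp)
  refine (contMDiffAt_vectorSpace_iff_contDiffAt (V := chartField φ u)).1 ?_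
  exact ContMDiffAt.mpullback_vectorField_preimage (n := ∞) (hu _)
    (contMDiffAt_symm_of_mem_maximalAtlas hφ hy) (mfderiv_symm_isInvertible hφ hy) (by simp)

theorem lieBracket_chartField (hφ : φ ∈ IsManifold.maximalAtlas (𝓡 n) ∞ M)
    {v w : (x : M) → TangentSpace (𝓡 n) x}
    (hv : ContMDiff (𝓡 n) (𝓡 n).tangent ∞ (fun x => (⟨x, v x⟩ : TangentBundle (𝓡 n) M)))
    (hw : ContMDiff (𝓡 n) (𝓡 n).tangent ∞ (fun x => (⟨x, w x⟩ : TangentBundle (𝓡 n) M)))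
    (hvw : ∀ x, VectorField.mlieBracket (𝓡 n) v w x = 0)
    {y : EuclideanSpace ℝ (Fin n)} (hy : y ∈ φ.target) :
    fderiv ℝ (chartField φ w) y (chartField φ v y) =
      fderiv ℝ (chartField φ v) y (chartField φ w y) := by
  have : IsManifold (𝓡 n) (minSmoothness ℝ 2) M := IsManifold.of_le (n := ∞) (by simpa using two_le_infty)
  have h := VectorField.mpullback_mlieBracket (n := ∞) (f := φ.symm) (x₀ := y)
    ((hv _).mdifferentiableAt (by simp)) ((hw _).mdifferentiableAt (by simp))
    (contMDiffAt_symm_of_mem_maximalAtlas hφ hy) (by simpa using two_le_infty)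
  rw [VectorField.mpullback_apply, hvw, map_zero, ← VectorField.mlieBracketWithin_univ,
    VectorField.mlieBracketWithin_eq_lieBracketWithin] at h
  have h' : 0 = VectorField.lieBracket ℝ (chartField φ v) (chartField φ w) y := by
    rw [← VectorField.lieBracketWithin_univ]
    exact h
  exact sub_eq_zero.1 h'.symm

omit [IsManifold (𝓡 n) ∞ M] in
theorem chartField_lin (hφ : φ ∈ IsManifold.maximalAtlas (𝓡 n) ∞ M)
    (v w : (x : M) → TangentSpace (𝓡 n) x) (a b : ℝ)
    {y : EuclideanSpace ℝ (Fin n)} (hy : y ∈ φ.target) :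
    chartField φ (fun x => a • v x + b • w x) y = a • chartField φ v y + b • chartField φ w y := by
  rw [chartField_eq hφ _ hy, chartField_eq hφ _ hy, chartField_eq hφ _ hy, map_add, map_smul,
    map_smul]
  rfl

omit [IsManifold (𝓡 n) ∞ M] in
theorem chart_comp_symm_contDiffAt (hφ : φ ∈ IsManifold.maximalAtlas (𝓡 n) ∞ M)
    (hψ : ψ ∈ IsManifold.maximalAtlas (𝓡 n) ∞ M) {x : M} (hx : x ∈ φ.source) (hx' : x ∈ ψ.source) :
    ContDiffAt ℝ ∞ (ψ ∘ φ.symm) (φ x) := by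
  rw [← contMDiffAt_iff_contDiffAt]
  refine ContMDiffAt.comp (I' := 𝓡 n) (φ x) ?_
    (contMDiffAt_symm_of_mem_maximalAtlas hφ (φ.map_source hx))
  rw [φ.left_inv hx]
  exact contMDiffAt_of_mem_maximalAtlas hψ hx'

/-- At a zero of a vector field, the derivatives of its expressions in two charts are conjugate. -/
theorem trace_fderiv_chartField_pow (hφ : φ ∈ IsManifold.maximalAtlas (𝓡 n) ∞ M)
    (hψ : ψ ∈ IsManifold.maximalAtlas (𝓡 n) ∞ M) {u : (x : M) → TangentSpace (𝓡 n) x}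
    (hu : ContMDiff (𝓡 n) (𝓡 n).tangent ∞ (fun x => (⟨x, u x⟩ : TangentBundle (𝓡 n) M)))
    {x : M} (hx : x ∈ φ.source) (hx' : x ∈ ψ.source) (hux : u x = 0) (k : ℕ) :
    LinearMap.trace ℝ _ ((fderiv ℝ (chartField φ u) (φ x) ^ k : EuclideanSpace ℝ (Fin n) →L[ℝ]
      EuclideanSpace ℝ (Fin n)) : EuclideanSpace ℝ (Fin n) →ₗ[ℝ] EuclideanSpace ℝ (Fin n)) =
    LinearMap.trace ℝ _ ((fderiv ℝ (chartField ψ u) (ψ x) ^ k : EuclideanSpace ℝ (Fin n) →L[ℝ]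
      EuclideanSpace ℝ (Fin n)) : EuclideanSpace ℝ (Fin n) →ₗ[ℝ] EuclideanSpace ℝ (Fin n)) := by
  have hχ := chart_comp_symm_contDiffAt hφ hψ hx hx'
  have hχ' := chart_comp_symm_contDiffAt hψ hφ hx' hx
  set χ := ψ ∘ φ.symm with hχdef
  set χ' := φ ∘ ψ.symm with hχdef'
  have hχx : χ (φ x) = ψ x := by simp [hχdef, φ.left_inv hx]
  have hχx' : χ' (ψ x) = φ x := by simp [hχdef', ψ.left_inv hx']
  -- near `φ x`
  have hsrc : ∀ᶠ y in 𝓝 (φ x), y ∈ φ.target ∧ φ.symm y ∈ ψ.source := by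
    refine (φ.open_target.eventually_mem (φ.map_source hx)).and ?_
    refine (φ.continuousAt_symm (φ.map_source hx)).eventually_mem ?_
    rw [φ.left_inv hx]
    exact ψ.open_source.mem_nhds hx'
  have htrans : ∀ᶠ y in 𝓝 (φ x), chartField ψ u (χ y) = fderiv ℝ χ y (chartField φ u y) := by
    filter_upwards [hsrc] with y hy
    have h1 := chartField_apply hψ u hy.2
    rw [chartField_eq hφ u hy.1]
    refine h1.trans ?_
    have h2 : mfderiv (𝓡 n) (𝓡 n) χ y = (mfderiv (𝓡 n) (𝓡 n) ψ (φ.symm y)).comp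
        (mfderiv (𝓡 n) (𝓡 n) φ.symm y) := by
      refine mfderiv_comp y ?_ ?_
      · exact (contMDiffAt_of_mem_maximalAtlas hψ hy.2).mdifferentiableAt (by simp)
      · exact (contMDiffAt_symm_of_mem_maximalAtlas hφ hy.1).mdifferentiableAt (by simp)
    rw [← mfderiv_eq_fderiv, h2]
    have h3 := (mdifferentiable_of_mem_maximalAtlas hφ).symm_comp_deriv (φ.map_target hy.1)
    rw [φ.right_inv hy.1] at h3
    have h4 : mfderiv (𝓡 n) (𝓡 n) φ.symm y (mfderiv (𝓡 n) (𝓡 n) φ (φ.symm y) (u (φ.symm y))) =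
      u (φ.symm y) := DFunLike.congr_fun h3 _
    exact (congrArg (mfderiv (𝓡 n) (𝓡 n) ψ (φ.symm y)) h4).symm
  have hzero : chartField φ u (φ x) = 0 := by
    rw [chartField_apply hφ u hx, hux]
    exact map_zero _
  set P := fderiv ℝ χ (φ x) with hP
  set Q := fderiv ℝ χ' (ψ x) with hQ
  set A := fderiv ℝ (chartField φ u) (φ x) with hA
  set B := fderiv ℝ (chartField ψ u) (ψ x) with hB
  have hdφ := ((contDiffAt_chartField hφ hu (φ.map_source hx)).differentiableAt
    (by simp)).hasFDerivAt
  have hdψ := ((contDiffAt_chartField hψ hu (ψ.map_source hx')).differentiableAt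
    (by simp)).hasFDerivAt
  have hdχ := (hχ.differentiableAt (by simp)).hasFDerivAt
  have hdχ' := (hχ'.differentiableAt (by simp)).hasFDerivAt
  have hconj : B.comp P = P.comp A := by
    have h1 : HasFDerivAt (fun y => chartField ψ u (χ y)) (B.comp P) (φ x) := by
      rw [← hχx] at hdψ
      have := hdψ.comp (φ x) hdχ
      rwa [hχx] at this
    -- Differentiating the transformation law `htrans` produces a term with the second derivative of
    -- `χ`; it is applied to the value of the field at the zero and drops out.
    have hd2 : DifferentiableAt ℝ (fderiv ℝ χ) (φ x) :=
      (hχ.fderiv_right (m := 1) (by rw [one_add_one_eq_two]; exact two_le_infty)).differentiableAt (by simp)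
    have h2 := hd2.hasFDerivAt.clm_apply hdφ
    rw [hzero] at h2
    have h3 := (h1.congr_of_eventuallyEq (EventuallyEq.symm htrans)).unique h2
    refine h3.trans ?_
    ext1 z
    simp [hP, hA]
  have hPQ : P.comp Q = ContinuousLinearMap.id ℝ _ := by
    have h1 : HasFDerivAt (χ ∘ χ') (P.comp Q) (ψ x) := by
      rw [← hχx'] at hdχ
      have := hdχ.comp (ψ x) hdχ'
      rwa [hχx'] at this
    refine h1.unique ((hasFDerivAt_id (ψ x)).congr_of_eventuallyEq ?_)
    have : ∀ᶠ y in 𝓝 (ψ x), y ∈ ψ.target ∧ ψ.symm y ∈ φ.source := by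
      refine (ψ.open_target.eventually_mem (ψ.map_source hx')).and ?_
      refine (ψ.continuousAt_symm (ψ.map_source hx')).eventually_mem ?_
      rw [ψ.left_inv hx']
      exact φ.open_source.mem_nhds hx
    filter_upwards [this] with y hy
    simp [hχdef, hχdef', φ.left_inv hy.2, ψ.right_inv hy.1]
  have hQP : Q.comp P = ContinuousLinearMap.id ℝ _ := by
    have h1 : HasFDerivAt (χ' ∘ χ) (Q.comp P) (φ x) := by
      rw [← hχx] at hdχ'
      have := hdχ'.comp (φ x) hdχ
      rwa [hχx] at this
    refine h1.unique ((hasFDerivAt_id (φ x)).congr_of_eventuallyEq ?_)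
    filter_upwards [hsrc] with y hy
    simp [hχdef, hχdef', ψ.left_inv hy.2, φ.right_inv hy.1]
  have hpow : (B ^ k).comp P = P.comp (A ^ k) := by
    have : B * P = P * A := hconj
    exact (SemiconjBy.pow_right (a := P) (x := A) (y := B) this.symm k).symm
  have hBk : B ^ k = (P.comp (A ^ k)).comp Q := by
    rw [← hpow, ContinuousLinearMap.comp_assoc, hPQ, ContinuousLinearMap.comp_id]
  have hAk : A ^ k = Q.comp (P.comp (A ^ k)) := by
    rw [← ContinuousLinearMap.comp_assoc, hQP, ContinuousLinearMap.id_comp]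
  rw [hBk]
  conv_lhs => rw [hAk]
  exact LinearMap.trace_mul_comm ℝ (Q : EuclideanSpace ℝ (Fin n) →ₗ[ℝ] EuclideanSpace ℝ (Fin n))
    ((P.comp (A ^ k) : EuclideanSpace ℝ (Fin n) →L[ℝ] EuclideanSpace ℝ (Fin n)) :
      EuclideanSpace ℝ (Fin n) →ₗ[ℝ] EuclideanSpace ℝ (Fin n))

omit [IsManifold (𝓡 n) ∞ M] in
/-- The expression in a chart of an integral curve is an integral curve. -/
theorem hasDerivAt_chart_comp (hφ : φ ∈ IsManifold.maximalAtlas (𝓡 n) ∞ M)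
    {u : (x : M) → TangentSpace (𝓡 n) x} {γ : ℝ → M} (hγ : IsMIntegralCurve (I := 𝓡 n) γ u) {t : ℝ}
    (ht : γ t ∈ φ.source) :
    HasDerivAt (fun s => φ (γ s))
      (mfderiv (𝓡 n) (𝓡 n) φ (γ t) (u (γ t)) : EuclideanSpace ℝ (Fin n)) t := by
  have h1 := ((contMDiffAt_of_mem_maximalAtlas hφ ht).mdifferentiableAt (by simp)).hasMFDerivAt
  have h2 : HasFDerivAt (fun s => φ (γ s)) ((1 : ℝ →L[ℝ] ℝ).smulRight
      (mfderiv (𝓡 n) (𝓡 n) φ (γ t) (u (γ t)) : EuclideanSpace ℝ (Fin n))) t := by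
    refine (hasMFDerivAt_iff_hasFDerivAt.1 (h1.comp t (hγ t))).congr_fderiv ?_
    ext1
    exact map_smul (mfderiv (𝓡 n) (𝓡 n) φ (γ t)) _ _
  exact h2.hasDerivAt.congr_deriv (one_smul ℝ _)

end ChartFields

/-! ### Lax equations and conservation of traces -/

section Isospectral

variable {E : Type*} [NormedAddCommGroup E] [NormedSpace ℝ E]

/-- The derivative of a vector field `u` along a trajectory of a commuting vector field `z`, on
which `u` vanishes, satisfies a Lax equation. -/
theorem hasDerivAt_fderiv_of_commute {u z : E → E} {c : ℝ → E} {t : ℝ}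
    (hu : ContDiffAt ℝ ∞ u (c t)) (hz : ContDiffAt ℝ ∞ z (c t)) (hc : HasDerivAt c (z (c t)) t)
    (h0 : u (c t) = 0) (hcomm : ∀ᶠ y in 𝓝 (c t), fderiv ℝ z y (u y) = fderiv ℝ u y (z y)) :
    HasDerivAt (fun s => fderiv ℝ u (c s))
      (fderiv ℝ z (c t) * fderiv ℝ u (c t) - fderiv ℝ u (c t) * fderiv ℝ z (c t)) t := by
  have two : (1 : WithTop ℕ∞) + 1 ≤ ∞ := by rw [one_add_one_eq_two]; exact two_le_infty
  have hdu := ((hu.fderiv_right (m := 1) two).differentiableAt (by simp)).hasFDerivAt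
  have hdz := ((hz.fderiv_right (m := 1) two).differentiableAt (by simp)).hasFDerivAt
  have hu' := (hu.differentiableAt (by simp)).hasFDerivAt
  have hz' := (hz.differentiableAt (by simp)).hasFDerivAt
  refine (hdu.comp_hasDerivAt t hc).congr_deriv ?_
  -- Differentiate `Dz · u = Du · z` in the direction `h`. As `u` vanishes at the point, what
  -- remains is `Dz Du h = D²u(h, z) + Du Dz h`; by symmetry `D²u(h, z)` is the derivative of `Du`
  -- along the trajectory, applied to `h`.
  have h1 := (hdz.clm_apply hu').congr_of_eventuallyEq (EventuallyEq.symm hcomm)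
  have h2 := h1.unique (hdu.clm_apply hz')
  have hsymm : IsSymmSndFDerivAt ℝ u (c t) := hu.isSymmSndFDerivAt (by simpa using two_le_infty)
  ext1 h
  have h3 := DFunLike.congr_fun h2 h
  simp only [h0, add_apply, ContinuousLinearMap.comp_apply,
    ContinuousLinearMap.flip_apply, map_zero, add_zero] at h3
  rw [hsymm.eq]
  simp only [sub_apply, mul_apply_eq_comp]
  rw [h3]
  abel

/-- The commutator with `B` is a derivation, so powers of a solution obey the same equation. -/
theorem HasDerivAt.pow_of_lax {R : Type*} [NormedRing R] [NormedAlgebra ℝ R] {A : ℝ → R} {B : R}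
    {t : ℝ} (h : HasDerivAt A (B * A t - A t * B) t) (k : ℕ) :
    HasDerivAt (fun s => A s ^ k) (B * A t ^ k - A t ^ k * B) t := by
  induction k with
  | zero => simpa using hasDerivAt_const t (1 : R)
  | succ k ih =>
    simp only [pow_succ]
    refine (ih.mul h).congr_deriv ?_
    noncomm_ring

variable [FiniteDimensional ℝ E]

variable (E) in
/-- The trace as a continuous linear form on the continuous endomorphisms. -/
noncomputable def traceCLM : (E →L[ℝ] E) →L[ℝ] ℝ :=
  LinearMap.toContinuousLinearMap (LinearMap.trace ℝ E ∘ₗ ContinuousLinearMap.coeLM ℝ)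

theorem traceCLM_apply (A : E →L[ℝ] E) : traceCLM E A = LinearMap.trace ℝ E (A : E →ₗ[ℝ] E) := rfl

theorem hasDerivAt_trace_pow_of_lax {A : ℝ → E →L[ℝ] E} {B : E →L[ℝ] E} {t : ℝ}
    (h : HasDerivAt A (B * A t - A t * B) t) (k : ℕ) :
    HasDerivAt (fun s => traceCLM E (A s ^ k)) 0 t := by
  refine ((traceCLM E).hasFDerivAt.comp_hasDerivAt t (h.pow_of_lax k)).congr_deriv ?_
  rw [map_sub, sub_eq_zero]
  exact LinearMap.trace_mul_comm ℝ (B : E →ₗ[ℝ] E) ((A t ^ k : E →L[ℝ] E) : E →ₗ[ℝ] E)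

theorem traceCLM_pow_of_diagonal {n : ℕ}
    {A : EuclideanSpace ℝ (Fin n) →L[ℝ] EuclideanSpace ℝ (Fin n)} {μ : Fin n → ℝ}
    (hA : ∀ y j, A y j = μ j * y j) (k : ℕ) :
    traceCLM _ (A ^ k) = ∑ j, μ j ^ k := by
  rw [traceCLM_apply, LinearMap.trace_eq_sum_inner _ (EuclideanSpace.basisFun (Fin n) ℝ)]
  refine Finset.sum_congr rfl fun i _ => ?_
  have : ∀ k (y : EuclideanSpace ℝ (Fin n)) j, (A ^ k) y j = μ j ^ k * y j := by
    intro k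
    induction k with
    | zero => simp
    | succ k ih =>
      intro y j
      rw [pow_succ, mul_apply_eq_comp, ih, hA, pow_succ, mul_assoc]
  rw [EuclideanSpace.basisFun_apply]
  change inner ℝ (EuclideanSpace.single i (1 : ℝ)) ((A ^ k) (EuclideanSpace.single i 1)) = _
  rw [EuclideanSpace.inner_single_left, this]
  simp

end Isospectral

/-! ### Constancy of the spectrum along a critical edge -/

section Edges

variable {n : ℕ} {M : Type*} [TopologicalSpace M] [ChartedSpace (EuclideanSpace ℝ (Fin n)) M]
  [IsManifold (𝓡 n) ∞ M]

namespace TwoMorse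

/-- The combination `a v + b w` of the two vector fields. -/
noncomputable def field (D : TwoMorse n M) (a b : ℝ) (x : M) : TangentSpace (𝓡 n) x := a • D.v x + b • D.w x

theorem contMDiff_field (D : TwoMorse n M) (a b : ℝ) :
    ContMDiff (𝓡 n) (𝓡 n).tangent ∞ (fun x => (⟨x, D.field a b x⟩ : TangentBundle (𝓡 n) M)) :=
  (D.smooth_v.const_smul_section (a := a)).add_section (D.smooth_w.const_smul_section (a := b))

variable {φ : OpenPartialHomeomorph M (EuclideanSpace ℝ (Fin n))}

theorem fderiv_chartField_field (D : TwoMorse n M)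
    (hφ : φ ∈ IsManifold.maximalAtlas (𝓡 n) ∞ M) (a b : ℝ) {y : EuclideanSpace ℝ (Fin n)}
    (hy : y ∈ φ.target) : fderiv ℝ (chartField φ (D.field a b)) y =
      a • fderiv ℝ (chartField φ D.v) y + b • fderiv ℝ (chartField φ D.w) y := by
  have h1 : chartField φ (D.field a b) =ᶠ[𝓝 y]
      a • chartField φ D.v + b • chartField φ D.w := by
    filter_upwards [φ.open_target.mem_nhds hy] with x hx
    exact chartField_lin hφ D.v D.w a b hx
  have hv := (contDiffAt_chartField hφ D.smooth_v hy).differentiableAt (by simp)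
  have hw := (contDiffAt_chartField hφ D.smooth_w hy).differentiableAt (by simp)
  rw [h1.fderiv_eq, fderiv_add (hv.const_smul a) (hw.const_smul b), fderiv_const_smul hv,
    fderiv_const_smul hw]

theorem commute_chartField (D : TwoMorse n M)
    (hφ : φ ∈ IsManifold.maximalAtlas (𝓡 n) ∞ M) (a b c d : ℝ) {y : EuclideanSpace ℝ (Fin n)}
    (hy : y ∈ φ.target) :
    fderiv ℝ (chartField φ (D.field c d)) y (chartField φ (D.field a b) y) =
      fderiv ℝ (chartField φ (D.field a b)) y (chartField φ (D.field c d) y) := by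
  have h1 := lieBracket_chartField hφ D.smooth_v D.smooth_w D.commute hy
  have h2 := chartField_lin hφ D.v D.w a b hy
  have h3 := chartField_lin hφ D.v D.w c d hy
  change chartField φ (D.field a b) y = _ at h2
  change chartField φ (D.field c d) y = _ at h3
  rw [D.fderiv_chartField_field hφ _ _ hy, D.fderiv_chartField_field hφ _ _ hy, h2, h3]
  simp only [add_apply, smul_apply, map_add, map_smul, h1]
  module

/-- The trace of the `k`-th power of the linearization of a field, at a point where it vanishes. -/
noncomputable def tracePow (u : (x : M) → TangentSpace (𝓡 n) x) (k : ℕ) (x : M) : ℝ :=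
  traceCLM _ (fderiv ℝ (chartField (chartAt (EuclideanSpace ℝ (Fin n)) x) u)
    (chartAt (EuclideanSpace ℝ (Fin n)) x x) ^ k)

/-- `tracePow` uses a chart that varies with the point. This independence of the chart allows
differentiating it along a curve in one fixed chart. -/
theorem tracePow_eq (hφ : φ ∈ IsManifold.maximalAtlas (𝓡 n) ∞ M)
    {u : (x : M) → TangentSpace (𝓡 n) x}
    (hu : ContMDiff (𝓡 n) (𝓡 n).tangent ∞ (fun x => (⟨x, u x⟩ : TangentBundle (𝓡 n) M)))
    {x : M} (hx : x ∈ φ.source) (hux : u x = 0) (k : ℕ) :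
    tracePow u k x = traceCLM _ (fderiv ℝ (chartField φ u) (φ x) ^ k) :=
  trace_fderiv_chartField_pow (IsManifold.chart_mem_maximalAtlas x) hφ hu
    (mem_chart_source _ x) hx hux k

theorem field_eq_zero {D : TwoMorse n M} {d : Plane} {γ : ℝ → M} (h : IsEdgeCurve D.v D.w d γ)
    (t : ℝ) : D.field d.2 (-d.1) (γ t) = 0 := by
  have := h.vanish t
  rw [field, neg_smul, ← sub_eq_add_neg]
  exact this

/-- The spectrum of the linearization of `b v - a w` is constant along an edge of direction
`(a, b)`. -/
theorem tracePow_edge_const {D : TwoMorse n M} {d : Plane} {γ : ℝ → M}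
    (h : IsEdgeCurve D.v D.w d γ) (k : ℕ) (s t : ℝ) :
    tracePow (D.field d.2 (-d.1)) k (γ s) = tracePow (D.field d.2 (-d.1)) k (γ t) := by
  have key : ∀ t₀, HasDerivAt (fun t => tracePow (D.field d.2 (-d.1)) k (γ t)) 0 t₀ := by
    intro t₀
    set φ := chartAt (EuclideanSpace ℝ (Fin n)) (γ t₀) with hφdef
    have hφ : φ ∈ IsManifold.maximalAtlas (𝓡 n) ∞ M := IsManifold.chart_mem_maximalAtlas _
    have hγ : IsMIntegralCurve (I := 𝓡 n) γ (D.field d.1 d.2) := h.integral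
    have hmem : γ t₀ ∈ φ.source := mem_chart_source _ _
    have hcd := hasDerivAt_chart_comp hφ hγ hmem
    rw [← chartField_apply hφ _ hmem] at hcd
    have h1 := hasDerivAt_fderiv_of_commute (c := fun s => φ (γ s))
      (contDiffAt_chartField hφ (D.contMDiff_field d.2 (-d.1)) (φ.map_source hmem))
      (contDiffAt_chartField hφ (D.contMDiff_field d.1 d.2) (φ.map_source hmem)) hcd
      (by
        change chartField φ (D.field d.2 (-d.1)) (φ (γ t₀)) = 0
        rw [chartField_apply hφ _ hmem, field_eq_zero h]
        exact map_zero _)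
      (by
        filter_upwards [φ.open_target.mem_nhds (φ.map_source hmem)] with y hy
        exact D.commute_chartField hφ _ _ _ _ hy)
    refine (hasDerivAt_trace_pow_of_lax h1 k).congr_of_eventuallyEq ?_
    filter_upwards [hγ.continuous.continuousAt.eventually_mem (φ.open_source.mem_nhds hmem)]
      with t ht
    exact tracePow_eq hφ (D.contMDiff_field _ _) ht (field_eq_zero h t) k
  exact is_const_of_deriv_eq_zero (fun t => (key t).differentiableAt) (fun t => (key t).deriv) s t

theorem chartField_linearization {D : TwoMorse n M} {p : M} {α : Fin n → Plane}
    (h : IsLinearization D.v D.w p φ α) (a b : ℝ) {y : EuclideanSpace ℝ (Fin n)}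
    (hy : y ∈ φ.target) (j : Fin n) :
    chartField φ (D.field a b) y j = (a * (α j).1 + b * (α j).2) * y j := by
  have h2 : chartField φ (D.field a b) y = _ := chartField_lin h.mem_atlas D.v D.w a b hy
  have hv : chartField φ D.v y = WithLp.toLp 2 fun j => (α j).1 * φ (φ.symm y) j :=
    (chartField_eq h.mem_atlas _ hy).trans (h.linear_v _ (φ.map_target hy))
  have hw : chartField φ D.w y = WithLp.toLp 2 fun j => (α j).2 * φ (φ.symm y) j :=
    (chartField_eq h.mem_atlas _ hy).trans (h.linear_w _ (φ.map_target hy))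
  rw [h2, hv, hw, φ.right_inv hy]
  simp only [PiLp.add_apply, PiLp.smul_apply, smul_eq_mul]
  ring

/-- In a linearizing chart the derivative of the field is the same diagonal matrix at every point.
Hence the characters at `p` can be read off at any zero in the chart, in particular on the part of
an edge near its end, and no limit is needed. -/
theorem tracePow_linearization {D : TwoMorse n M} {p : M} {α : Fin n → Plane}
    (h : IsLinearization D.v D.w p φ α) (a b : ℝ) {x : M} (hx : x ∈ φ.source)
    (hux : D.field a b x = 0) (k : ℕ) :
    tracePow (D.field a b) k x = ∑ j, (a * (α j).1 + b * (α j).2) ^ k := by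
  rw [tracePow_eq h.mem_atlas (D.contMDiff_field a b) hx hux]
  apply traceCLM_pow_of_diagonal
  intro z j
  let L : EuclideanSpace ℝ (Fin n) →L[ℝ] EuclideanSpace ℝ (Fin n) := LinearMap.toContinuousLinearMap
    { toFun := fun y => WithLp.toLp 2 fun j => (a * (α j).1 + b * (α j).2) * y j
      map_add' := fun y z => by ext j; simp [mul_add]
      map_smul' := fun c y => by ext j; simp; ring }
  have hL : chartField φ (D.field a b) =ᶠ[𝓝 (φ x)] L := by
    filter_upwards [φ.open_target.mem_nhds (φ.map_source hx)] with y hy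
    ext j
    rw [chartField_linearization h a b hy]
    rfl
  rw [hL.fderiv_eq, L.fderiv]
  rfl

/-- The characters at the two ends of an edge, restricted to the subgroup acting trivially on the
edge, have the same power sums. -/
theorem sum_pow_eq_of_isEdge (D : TwoMorse n M) {e : Set M} {p q : D.CriticalPoint} {d : Plane}
    (h : D.IsEdge e p q d) (k : ℕ) :
    ∑ j, Plane.area (D.weight p j) d ^ k = ∑ j, Plane.area (D.weight q j) d ^ k := by
  obtain ⟨γ, hγ, -, hp, hq⟩ := h
  have key : ∀ (r : D.CriticalPoint) (t : ℝ), γ t ∈ (D.linChart r).source →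
      tracePow (D.field d.2 (-d.1)) k (γ t) = ∑ j, Plane.area (D.weight r j) d ^ k := by
    intro r t ht
    rw [tracePow_linearization (D.isLinearization r) _ _ ht (field_eq_zero hγ t)]
    refine Finset.sum_congr rfl fun j _ => ?_
    rw [Plane.area]
    congr 1
    ring
  obtain ⟨s, hs⟩ := (hp.eventually_mem ((D.linChart p).open_source.mem_nhds
    (D.isLinearization p).mem_source)).exists
  obtain ⟨t, ht⟩ := (hq.eventually_mem ((D.linChart q).open_source.mem_nhds
    (D.isLinearization q).mem_source)).exists
  rw [← key p s hs, ← key q t ht]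
  exact tracePow_edge_const hγ k s t

end TwoMorse

end Edges

/-! ### Power sums, and the absence of continuous injections of a disc into the line -/

-- Equal power sums give equal sums of values of every polynomial; take one that interpolates the
-- indicator of the positive reals at all the points involved.
open Classical in
theorem card_pos_eq_of_sum_pow_eq {ι : Type*} [Fintype ι] {x y : ι → ℝ}
    (h : ∀ k : ℕ, ∑ i, x i ^ k = ∑ i, y i ^ k) :
    (Finset.univ.filter fun i => 0 < x i).card = (Finset.univ.filter fun i => 0 < y i).card := by
  have hpoly : ∀ P : Polynomial ℝ, ∑ i, P.eval (x i) = ∑ i, P.eval (y i) := by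
    intro P
    simp only [Polynomial.eval_eq_sum, Polynomial.sum]
    rw [Finset.sum_comm, Finset.sum_comm (s := Finset.univ)]
    refine Finset.sum_congr rfl fun k _ => ?_
    rw [← Finset.mul_sum, ← Finset.mul_sum, h]
  let s : Finset ℝ := Finset.univ.image x ∪ Finset.univ.image y
  let P := Lagrange.interpolate s id (fun a => if 0 < a then (1 : ℝ) else 0)
  have hP : ∀ a ∈ s, P.eval a = if 0 < a then 1 else 0 := fun a ha =>
    Lagrange.eval_interpolate_at_node _ (Function.injective_id.injOn) ha
  have h1 := hpoly P
  rw [Finset.sum_congr rfl fun i _ => hP (x i) (by simp [s]),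
    Finset.sum_congr rfl fun i _ => hP (y i) (by simp [s])] at h1
  simpa [Finset.sum_boole] using h1

/-- There is no injective continuous function on a neighbourhood of a point of the plane. -/
theorem not_injOn_ball_of_continuousOn {G : ℝ × ℝ → ℝ} {ε : ℝ} (hε : 0 < ε)
    (hc : ContinuousOn G (Metric.closedBall 0 ε)) (hi : InjOn G (Metric.closedBall 0 ε)) : False := by
  have hmem : ∀ s ∈ Icc (-ε) ε, ∀ r, |r| ≤ ε → (s, r) ∈ Metric.closedBall (0 : ℝ × ℝ) ε := by
    intro s hs r hr
    rw [mem_closedBall_zero_iff, Prod.norm_def]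
    exact max_le (abs_le.2 hs) hr
  have hab : ∀ s ∈ Icc (-ε) ε, abs (ε - |s|) ≤ ε := by
    intro s hs
    have := abs_le.2 hs
    rw [abs_le]
    constructor <;> linarith [abs_nonneg s]
  have hab' : ∀ s ∈ Icc (-ε) ε, abs (-(ε - |s|)) ≤ ε := fun s hs => by
    rw [abs_neg]; exact hab s hs
  have hle : -ε ≤ ε := by linarith
  -- Two arcs from `(-ε, 0)` to `(ε, 0)`, the upper and the lower half of a diamond. On both, `G`
  -- attains the mean of its end values; injectivity forces a common point of the arcs, which is an
  -- end point, where `G` differs from the mean.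
  have c1 : ContinuousOn (fun s => G (s, ε - |s|)) (Icc (-ε) ε) :=
    hc.comp (by fun_prop) fun s hs => hmem s hs _ (hab s hs)
  have c2 : ContinuousOn (fun s => G (s, -(ε - |s|))) (Icc (-ε) ε) :=
    hc.comp (by fun_prop) fun s hs => hmem s hs _ (hab' s hs)
  rw [← uIcc_of_le hle] at c1 c2
  have i1 := intermediate_value_uIcc c1
  have i2 := intermediate_value_uIcc c2
  simp only [abs_neg, abs_of_pos hε, sub_self, neg_zero] at i1 i2
  set m := (G (-ε, 0) + G (ε, 0)) / 2 with hm
  have hmid : m ∈ uIcc (G (-ε, 0)) (G (ε, 0)) := by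
    rw [mem_uIcc, hm]
    rcases le_total (G (-ε, 0)) (G (ε, 0)) with h | h
    · left; constructor <;> linarith
    · right; constructor <;> linarith
  obtain ⟨s, hs, h1⟩ := i1 hmid
  obtain ⟨r, hr, h2⟩ := i2 hmid
  rw [uIcc_of_le hle] at hs hr
  have h3 := hi (hmem s hs _ (hab s hs)) (hmem r hr _ (hab' r hr)) (h1.trans h2.symm)
  simp only [Prod.mk.injEq] at h3
  obtain ⟨rfl, h3⟩ := h3
  have hsε : |s| = ε := by linarith
  have h0 : (0 : ℝ) ∈ Icc (-ε) ε := ⟨by linarith, hε.le⟩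
  have hne : G (-ε, 0) ≠ G (ε, 0) := by
    intro h
    have := hi (hmem (-ε) ⟨le_rfl, hle⟩ 0 (by simpa using hε.le))
      (hmem ε ⟨hle, le_rfl⟩ 0 (by simpa using hε.le)) h
    simp only [Prod.mk.injEq, and_true] at this
    linarith
  simp only [hsε, sub_self] at h1
  rcases abs_eq hε.le |>.1 hsε with h | h
  · rw [h, hm] at h1
    apply hne; linarith
  · rw [h, hm] at h1
    apply hne; linarith

/-! ### Projection and local structure of critical edges -/

section Edges

variable {n : ℕ} {M : Type*} [TopologicalSpace M] [ChartedSpace (EuclideanSpace ℝ (Fin n)) M]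
  [IsManifold (𝓡 n) ∞ M]

namespace TwoMorse

variable {D : TwoMorse n M} {d : Plane} {γ : ℝ → M}

theorem IsEdge.reverse {e : Set M} {p q : D.CriticalPoint} (h : D.IsEdge e p q d) :
    D.IsEdge e q p (-d) := by
  obtain ⟨γ, hγ, hr, hp, hq⟩ := h
  have heq : (fun x => (-d).1 • D.v x + (-d).2 • D.w x) =
      (-1 : ℝ) • fun x => d.1 • D.v x + d.2 • D.w x := by
    funext x
    simp only [Pi.smul_apply, Prod.fst_neg, Prod.snd_neg]
    module
  refine ⟨γ ∘ fun t => t * (-1), ⟨?_, ?_, ?_, ?_⟩, ?_, ?_, ?_⟩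
  · simpa using hγ.unit
  · rw [heq]
    exact hγ.integral.comp_mul (-1)
  · intro t
    have := hγ.vanish (t * (-1))
    simp only [Function.comp_apply, Prod.fst_neg, Prod.snd_neg, neg_smul]
    rw [← neg_sub', this, neg_zero]
  · intro t
    have := hγ.moving (t * (-1))
    simp only [Function.comp_apply, Prod.fst_neg, Prod.snd_neg, neg_smul]
    rw [← neg_add]
    exact neg_ne_zero.2 this
  · rw [range_comp, Function.Surjective.range_eq (f := fun t : ℝ => t * -1) fun t => ⟨-t, by simp⟩, image_univ, hr]
  · exact hq.comp (by simpa using tendsto_neg_atBot_atTop)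
  · exact hp.comp (by simpa using tendsto_neg_atTop_atBot)

theorem smul_field {x : M} (hd : d.1 ^ 2 + d.2 ^ 2 = 1) (h : D.field d.2 (-d.1) x = 0) :
    D.v x = d.1 • D.field d.1 d.2 x ∧ D.w x = d.2 • D.field d.1 d.2 x := by
  have h1 : d.2 • D.v x = d.1 • D.w x := by
    rw [field, neg_smul, ← sub_eq_add_neg, sub_eq_zero] at h
    exact h
  constructor
  · rw [field, smul_add, smul_comm d.1 d.2, ← h1, smul_smul, smul_smul, ← add_smul, ← pow_two,
      ← pow_two, hd, one_smul]
  · rw [field, smul_add, smul_comm d.2 d.1, h1, smul_smul, smul_smul, ← add_smul, ← pow_two,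
      ← pow_two, hd, one_smul]

/-- Along an edge the two functions move in the direction of the edge. -/
theorem exists_hasDerivAt_proj (h : IsEdgeCurve D.v D.w d γ) (t : ℝ) : ∃ N > 0,
    HasDerivAt (fun s => D.fv (γ s)) (d.1 * N) t ∧ HasDerivAt (fun s => D.fw (γ s)) (d.2 * N) t := by
  set z := D.field d.1 d.2 (γ t) with hz
  obtain ⟨hv, hw⟩ := smul_field h.unit (field_eq_zero h t)
  rw [← hz] at hv hw
  have hint : HasMFDerivAt 𝓘(ℝ, ℝ) (𝓡 n) γ t ((1 : ℝ →L[ℝ] ℝ).smulRight z) := h.integral t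
  -- On the edge `v = a z` and `w = b z` with `z = a v + b w`, so both gradients paired with the
  -- velocity `z` are multiples of its squared length.
  refine ⟨D.metric.inner (γ t) z z, D.metric.pos _ _ (h.moving t), ?_, ?_⟩
  · have h1 := ((D.smooth_fv (γ t)).mdifferentiableAt (by simp)).hasMFDerivAt
    have h2 : HasFDerivAt (fun s => D.fv (γ s)) ((1 : ℝ →L[ℝ] ℝ).smulRight
        (mfderiv (𝓡 n) 𝓘(ℝ, ℝ) D.fv (γ t) z : ℝ)) t := by
      refine (hasMFDerivAt_iff_hasFDerivAt.1 (h1.comp t hint)).congr_fderiv ?_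
      ext1
      exact map_smul (mfderiv (𝓡 n) 𝓘(ℝ, ℝ) D.fv (γ t)) _ _
    refine h2.hasDerivAt.congr_deriv ((one_smul ℝ _).trans ?_)
    refine (D.gradient_v _ _).trans ?_
    rw [hv, map_smul]
    rfl
  · have h1 := ((D.smooth_fw (γ t)).mdifferentiableAt (by simp)).hasMFDerivAt
    have h2 : HasFDerivAt (fun s => D.fw (γ s)) ((1 : ℝ →L[ℝ] ℝ).smulRight
        (mfderiv (𝓡 n) 𝓘(ℝ, ℝ) D.fw (γ t) z : ℝ)) t := by
      refine (hasMFDerivAt_iff_hasFDerivAt.1 (h1.comp t hint)).congr_fderiv ?_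
      ext1
      exact map_smul (mfderiv (𝓡 n) 𝓘(ℝ, ℝ) D.fw (γ t)) _ _
    refine h2.hasDerivAt.congr_deriv ((one_smul ℝ _).trans ?_)
    refine (D.gradient_w _ _).trans ?_
    rw [hw, map_smul]
    rfl

theorem strictMono_edge (h : IsEdgeCurve D.v D.w d γ) :
    StrictMono fun s => d.1 * D.fv (γ s) + d.2 * D.fw (γ s) := by
  apply strictMono_of_deriv_pos
  intro t
  obtain ⟨N, hN, h1, h2⟩ := exists_hasDerivAt_proj h t
  rw [((h1.const_mul d.1).fun_add (h2.const_mul d.2)).deriv]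
  have := h.unit
  nlinarith

theorem edge_const (h : IsEdgeCurve D.v D.w d γ) (s t : ℝ) :
    d.2 * D.fv (γ s) - d.1 * D.fw (γ s) = d.2 * D.fv (γ t) - d.1 * D.fw (γ t) := by
  have key : ∀ t, HasDerivAt (fun s => d.2 * D.fv (γ s) - d.1 * D.fw (γ s)) 0 t := by
    intro t
    obtain ⟨N, hN, h1, h2⟩ := exists_hasDerivAt_proj h t
    exact ((h1.const_mul d.2).sub (h2.const_mul d.1)).congr_deriv (by ring)
  exact is_const_of_deriv_eq_zero (fun t => (key t).differentiableAt) (fun t => (key t).deriv) s t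

/-- The projection of an edge is a segment in the direction of the edge. -/
theorem IsEdge.proj_eq {e : Set M} {p q : D.CriticalPoint} (h : D.IsEdge e p q d) :
    ∃ l : ℝ, 0 < l ∧ D.proj q.1 = D.proj p.1 + l • d := by
  obtain ⟨γ, hγ, -, hp, hq⟩ := h
  have cv := D.smooth_fv.continuous
  have cw := D.smooth_fw.continuous
  have c1 : Continuous fun x => d.1 * D.fv x + d.2 * D.fw x := by fun_prop
  have c2 : Continuous fun x => d.2 * D.fv x - d.1 * D.fw x := by fun_prop
  have hmono := strictMono_edge hγ
  have h1 := hmono.monotone.le_of_tendsto ((c1.tendsto p.1).comp hp) 0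
  have h2 := hmono.monotone.ge_of_tendsto ((c1.tendsto q.1).comp hq) 1
  have h3 := hmono zero_lt_one
  have h4 : ∀ t, d.2 * D.fv (γ t) - d.1 * D.fw (γ t) = d.2 * D.fv (γ 0) - d.1 * D.fw (γ 0) :=
    fun t => edge_const hγ t 0
  have h5 : d.2 * D.fv p.1 - d.1 * D.fw p.1 = d.2 * D.fv (γ 0) - d.1 * D.fw (γ 0) :=
    tendsto_nhds_unique ((c2.tendsto p.1).comp hp) (by
      simp only [Function.comp_def, h4]
      exact tendsto_const_nhds)
  have h6 : d.2 * D.fv q.1 - d.1 * D.fw q.1 = d.2 * D.fv (γ 0) - d.1 * D.fw (γ 0) :=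
    tendsto_nhds_unique ((c2.tendsto q.1).comp hq) (by
      simp only [Function.comp_def, h4]
      exact tendsto_const_nhds)
  have hu := hγ.unit
  refine ⟨(d.1 * D.fv q.1 + d.2 * D.fw q.1) - (d.1 * D.fv p.1 + d.2 * D.fw p.1), ?_, ?_⟩
  · simp only at h1 h2 h3
    linarith
  · refine Prod.ext ?_ ?_
    · simp only [proj, Prod.fst_add, Prod.smul_fst, smul_eq_mul]
      linear_combination (-(D.fv q.1 - D.fv p.1)) * hu + d.2 * (h6 - h5)
    · simp only [proj, Prod.snd_add, Prod.smul_snd, smul_eq_mul]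
      linear_combination (-(D.fw q.1 - D.fw p.1)) * hu - d.1 * (h6 - h5)

section Linearization

variable {φ : OpenPartialHomeomorph M (EuclideanSpace ℝ (Fin n))} {p : M} {α : Fin n → Plane}

theorem field_eq_zero_iff (hL : IsLinearization D.v D.w p φ α) (a b : ℝ) {x : M}
    (hx : x ∈ φ.source) :
    D.field a b x = 0 ↔ ∀ j, (a * (α j).1 + b * (α j).2) * φ x j = 0 := by
  have h1 : ∀ j, chartField φ (D.field a b) (φ x) j = (a * (α j).1 + b * (α j).2) * φ x j :=
    chartField_linearization hL a b (φ.map_source hx)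
  have h2 := chartField_apply hL.mem_atlas (D.field a b) hx
  simp_rw [← h1]
  constructor
  · intro h j
    rw [h] at h2
    rw [h2]
    exact congrFun (congrArg _ (map_zero (mfderiv (𝓡 n) (𝓡 n) φ x))) j
  · intro h
    apply mfderiv_chart_injective hL.mem_atlas hx
    rw [map_zero]
    refine h2.symm.trans ?_
    ext j
    exact h j

/-- A zero character would make a piece of its coordinate axis consist of critical points, which are
isolated. -/
theorem weight_ne_zero (hL : IsLinearization D.v D.w p φ α) (hv : D.v p = 0) (hw : D.w p = 0)
    (j : Fin n) : α j ≠ 0 := by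
  intro hj
  have hp : φ.symm 0 = p := by rw [← hL.map_center, φ.left_inv hL.mem_source]
  have h0 : (0 : EuclideanSpace ℝ (Fin n)) ∈ φ.target := by
    rw [← hL.map_center]; exact φ.map_source hL.mem_source
  have hc : Tendsto (fun s : ℝ => s • EuclideanSpace.single j (1 : ℝ)) (𝓝[≠] 0)
      (𝓝 (0 : EuclideanSpace ℝ (Fin n))) := by
    have : Continuous fun s : ℝ => s • (EuclideanSpace.single j (1 : ℝ) :
      EuclideanSpace ℝ (Fin n)) := by fun_prop
    have := this.tendsto 0
    rw [zero_smul] at this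
    exact this.mono_left nhdsWithin_le_nhds
  have hmem := hc.eventually_mem (φ.open_target.mem_nhds h0)
  have hlim : Tendsto (fun s : ℝ => φ.symm (s • EuclideanSpace.single j (1 : ℝ))) (𝓝[≠] 0)
      (𝓝[≠] p) := by
    refine tendsto_nhdsWithin_iff.2 ⟨?_, ?_⟩
    · have := (φ.continuousAt_symm h0).tendsto.comp hc
      rwa [hp] at this
    · filter_upwards [hmem, self_mem_nhdsWithin] with s hs hs0 h
      have h1 : φ (φ.symm (s • EuclideanSpace.single j (1 : ℝ))) = 0 := by
        rw [show φ.symm (s • EuclideanSpace.single j (1 : ℝ)) = p from h, hL.map_center]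
      rw [φ.right_inv hs] at h1
      have h2 := congrFun (congrArg (fun y : EuclideanSpace ℝ (Fin n) => y.ofLp) h1) j
      simp at h2
      exact hs0 h2
  obtain ⟨s, hs, hs'⟩ := ((hlim.eventually (D.critical_isolated p hv hw)).and hmem).exists
  apply hs
  have hz : ∀ a b : ℝ, D.field a b (φ.symm (s • EuclideanSpace.single j (1 : ℝ))) = 0 := by
    intro a b
    rw [field_eq_zero_iff hL a b (φ.map_target hs')]
    intro i
    rw [φ.right_inv hs']
    rcases eq_or_ne i j with rfl | hij
    · simp [hj]
    · simp [hij]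
  constructor
  · simpa [field] using hz 1 0
  · simpa [field] using hz 0 1

theorem area_mul_coord_eq_zero (hL : IsLinearization D.v D.w p φ α)
    (h : IsEdgeCurve D.v D.w d γ) {t : ℝ} (ht : γ t ∈ φ.source) (j : Fin n) :
    Plane.area (α j) d * φ (γ t) j = 0 := by
  have := (field_eq_zero_iff hL _ _ ht).1 (field_eq_zero h t) j
  rw [← this, Plane.area]
  ring

theorem exists_dot_mul_coord_ne_zero (hL : IsLinearization D.v D.w p φ α)
    (h : IsEdgeCurve D.v D.w d γ) {t : ℝ} (ht : γ t ∈ φ.source) :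
    ∃ j, Plane.dot (α j) d * φ (γ t) j ≠ 0 := by
  by_contra! hcon
  apply h.moving t
  refine (field_eq_zero_iff hL d.1 d.2 ht).2 fun j => ?_
  rw [← hcon j, Plane.dot]
  ring

theorem hasDerivAt_coord (hL : IsLinearization D.v D.w p φ α)
    (h : IsEdgeCurve D.v D.w d γ) {t : ℝ} (ht : γ t ∈ φ.source) (j : Fin n) :
    HasDerivAt (fun s => φ (γ s) j) (Plane.dot (α j) d * φ (γ t) j) t := by
  have h1 := hasDerivAt_chart_comp hL.mem_atlas (u := D.field d.1 d.2) h.integral ht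
  rw [← chartField_apply hL.mem_atlas _ ht] at h1
  have h2 := (EuclideanSpace.proj (𝕜 := ℝ) j).hasFDerivAt.comp_hasDerivAt t h1
  refine h2.congr_deriv ?_
  have h3 := chartField_linearization hL d.1 d.2 (φ.map_source ht) j
  refine h3.trans ?_
  rw [Plane.dot]
  ring

theorem finrank_span_fields {x : M} (hd : d.1 ^ 2 + d.2 ^ 2 = 1)
    (h : D.field d.2 (-d.1) x = 0) (h' : D.field d.1 d.2 x ≠ 0) :
    Module.finrank ℝ (Submodule.span ℝ {D.v x, D.w x}) = 1 := by
  obtain ⟨hv, hw⟩ := smul_field hd h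
  have : Submodule.span ℝ {D.v x, D.w x} = Submodule.span ℝ {D.field d.1 d.2 x} := by
    apply le_antisymm
    · rw [Submodule.span_le]
      rintro y (rfl | rfl)
      · rw [hv]; exact Submodule.smul_mem _ _ (Submodule.mem_span_singleton_self _)
      · rw [hw]; exact Submodule.smul_mem _ _ (Submodule.mem_span_singleton_self _)
    · rw [Submodule.span_singleton_le_iff_mem]
      exact Submodule.add_mem _ (Submodule.smul_mem _ _ (Submodule.subset_span (by simp)))
        (Submodule.smul_mem _ _ (Submodule.subset_span (by simp)))
  rw [this]
  exact finrank_span_singleton h'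

/-- As critical edges are isolated, only one character is parallel to the direction of an edge. -/
theorem area_ne_zero_of_isEdgeCurve (hL : IsLinearization D.v D.w p φ α)
    (h : IsEdgeCurve D.v D.w d γ) {t : ℝ} (ht : γ t ∈ φ.source) {i j : Fin n}
    (hi : Plane.dot (α i) d * φ (γ t) i ≠ 0) (hij : j ≠ i) : Plane.area (α j) d ≠ 0 := by
  intro hj
  have hi0 : Plane.area (α i) d = 0 :=
    (mul_eq_zero.1 (area_mul_coord_eq_zero hL h ht i)).resolve_right (right_ne_zero_of_mul hi)
  -- The coordinate plane through `γ t` in the directions of two characters parallel to `d`. Near `γ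
  -- t` each of its points lies on a one-dimensional orbit, hence on `γ`, since edges are isolated.
  let P : ℝ × ℝ → EuclideanSpace ℝ (Fin n) := fun x =>
    φ (γ t) + x.1 • EuclideanSpace.single i (1 : ℝ) + x.2 • EuclideanSpace.single j (1 : ℝ)
  have hP : Continuous P := by fun_prop
  have hP0 : P 0 = φ (γ t) := by simp [P]
  have hPi : ∀ x, P x i = φ (γ t) i + x.1 := by intro x; simp [P, hij.symm]
  have hPj : ∀ x, P x j = φ (γ t) j + x.2 := by intro x; simp [P, hij]
  have hPk : ∀ x k, k ≠ i → k ≠ j → P x k = φ (γ t) k := by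
    intro x k hki hkj; simp [P, hki, hkj]
  have e1 : ∀ᶠ x in 𝓝 (0 : ℝ × ℝ), P x ∈ φ.target :=
    hP.continuousAt.eventually_mem (by rw [hP0]; exact φ.open_target.mem_nhds (φ.map_source ht))
  have e2 : ∀ᶠ x in 𝓝 (0 : ℝ × ℝ), P x i ≠ 0 := by
    have hc : Continuous fun x => P x i := by
      simp_rw [hPi]; fun_prop
    apply hc.continuousAt.eventually_ne
    rw [hP0]
    exact right_ne_zero_of_mul hi
  have e3 : ∀ᶠ x in 𝓝 (0 : ℝ × ℝ), Module.finrank ℝ (Submodule.span ℝ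
      {D.v (φ.symm (P x)), D.w (φ.symm (P x))}) = 1 → φ.symm (P x) ∈ range γ := by
    have hc : Tendsto (fun x => φ.symm (P x)) (𝓝 0) (𝓝 (γ t)) := by
      have h1 : ContinuousAt φ.symm (P 0) := φ.continuousAt_symm (by
        rw [hP0]; exact φ.map_source ht)
      have h2 := h1.tendsto.comp hP.continuousAt.tendsto
      rwa [hP0, φ.left_inv ht] at h2
    exact hc.eventually (D.edges_isolated d γ h t)
  obtain ⟨ε, hε, hball⟩ := Metric.nhds_basis_closedBall.eventually_iff.1 (e1.and (e2.and e3))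
  have hrange : ∀ x ∈ Metric.closedBall (0 : ℝ × ℝ) ε, φ.symm (P x) ∈ range γ := by
    intro x hx
    obtain ⟨h1, h2, h3⟩ := hball hx
    have hsrc := φ.map_target h1
    apply h3
    apply finrank_span_fields h.unit
    · rw [field_eq_zero_iff hL _ _ hsrc]
      intro k
      rw [φ.right_inv h1]
      have : d.2 * (α k).1 + -d.1 * (α k).2 = Plane.area (α k) d := by rw [Plane.area]; ring
      rw [this]
      rcases eq_or_ne k i with rfl | hki
      · rw [hi0, zero_mul]
      rcases eq_or_ne k j with rfl | hkj
      · rw [hj, zero_mul]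
      rw [hPk x k hki hkj]
      exact area_mul_coord_eq_zero hL h ht k
    · rw [Ne, field_eq_zero_iff hL _ _ hsrc]
      intro hall
      have := hall i
      rw [φ.right_inv h1] at this
      refine mul_ne_zero ?_ h2 this
      have h4 := left_ne_zero_of_mul hi
      rw [Plane.dot] at h4
      intro h5
      apply h4
      linarith
  have cv := D.smooth_fv.continuous
  have cw := D.smooth_fw.continuous
  have c1 : Continuous fun x => d.1 * D.fv x + d.2 * D.fw x := by fun_prop
  -- The function that strictly increases along `γ` would be injective on a two-dimensional disc.
  refine not_injOn_ball_of_continuousOn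
    (G := fun x => d.1 * D.fv (φ.symm (P x)) + d.2 * D.fw (φ.symm (P x))) hε ?_ ?_
  · exact c1.comp_continuousOn (φ.continuousOn_symm.comp hP.continuousOn fun x hx => (hball hx).1)
  · intro x hx y hy hxy
    obtain ⟨s, hs⟩ := hrange x hx
    obtain ⟨r, hr⟩ := hrange y hy
    simp only at hxy
    rw [← hs, ← hr] at hxy
    have hsr := (strictMono_edge h).injective hxy
    rw [hsr, hr] at hs
    have hxy' := φ.symm.injOn (hball hy).1 (hball hx).1 hs
    refine Prod.ext ?_ ?_
    · have h1 := hPi x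
      rw [← hxy', hPi y] at h1
      linarith
    · have h1 := hPj x
      rw [← hxy', hPj y] at h1
      linarith

end Linearization

/-- The local structure of an edge at its starting point: exactly one character is parallel to the
direction of the edge, it points along the edge, and the tangent line of the edge is the
corresponding coordinate line. -/
theorem IsEdge.exists_weight {e : Set M} {p q : D.CriticalPoint} (h : D.IsEdge e p q d) :
    ∃ (j : Fin n) (c : ℝ), 0 < c ∧ D.weight p j = c • d ∧ (∀ i, i ≠ j → Plane.area (D.weight p i) d ≠ 0) ∧
      D.tangentLine p e = Submodule.span ℝ {EuclideanSpace.single j (1 : ℝ)} := by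
  obtain ⟨γ, hγ, rfl, hp, -⟩ := h
  have hL := D.isLinearization p
  set φ := D.linChart p
  set α := D.weight p
  have hd0 : d ≠ 0 := by
    rintro rfl
    have := hγ.unit
    norm_num at this
  have hev := hp.eventually_mem (φ.open_source.mem_nhds hL.mem_source)
  obtain ⟨t₀, ht₀⟩ := eventually_atBot.1 hev
  obtain ⟨j, hj⟩ := exists_dot_mul_coord_ne_zero hL hγ (ht₀ t₀ le_rfl)
  have huniq : ∀ i, i ≠ j → Plane.area (α i) d ≠ 0 := fun i hi =>
    area_ne_zero_of_isEdgeCurve hL hγ (ht₀ t₀ le_rfl) hj hi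
  have hcoord : ∀ t, γ t ∈ φ.source → ∀ i, i ≠ j → φ (γ t) i = 0 := fun t ht i hi =>
    (mul_eq_zero.1 (area_mul_coord_eq_zero hL hγ ht i)).resolve_left (huniq i hi)
  have hne : ∀ t, γ t ∈ φ.source → φ (γ t) j ≠ 0 := by
    intro t ht
    obtain ⟨i, hi⟩ := exists_dot_mul_coord_ne_zero hL hγ ht
    by_cases hij : i = j
    · rw [← hij]; exact right_ne_zero_of_mul hi
    · rw [hcoord t ht i hij, mul_zero] at hi
      exact absurd rfl hi
  have harea : Plane.area (α j) d = 0 :=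
    (mul_eq_zero.1 (area_mul_coord_eq_zero hL hγ (ht₀ t₀ le_rfl) j)).resolve_right
      (right_ne_zero_of_mul hj)
  have hlim : Tendsto (fun t => φ (γ t)) atBot (𝓝 0) := by
    have := (φ.continuousAt hL.mem_source).tendsto.comp hp
    rwa [hL.map_center] at this
  have hpos : 0 < Plane.dot (α j) d := by
    rcases lt_or_gt_of_ne (left_ne_zero_of_mul hj) with hneg | hpos
    swap
    · exact hpos
    exfalso
    -- If the exponent were negative, the square of the coordinate would not increase on `(-∞, t₀]`.
    -- It tends to `0` at `-∞` but is positive at `t₀`.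
    have hd : ∀ t ≤ t₀, HasDerivAt (fun s => φ (γ s) j ^ 2)
        (2 * Plane.dot (α j) d * φ (γ t) j ^ 2) t := by
      intro t ht
      refine ((hasDerivAt_coord hL hγ (ht₀ t ht) j).pow 2).congr_deriv ?_
      ring
    have hanti : AntitoneOn (fun s => φ (γ s) j ^ 2) (Iic t₀) := by
      refine antitoneOn_of_deriv_nonpos (convex_Iic t₀)
        (fun t ht => (hd t ht).continuousAt.continuousWithinAt)
        (fun t ht => (hd t (interior_subset (s := Iic t₀) ht)).differentiableAt.differentiableWithinAt) ?_
      intro t ht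
      rw [(hd t (interior_subset (s := Iic t₀) ht)).deriv]
      nlinarith [sq_nonneg (φ (γ t) j)]
    have hlim2 : Tendsto (fun t => φ (γ t) j ^ 2) atBot (𝓝 0) := by
      have h1 := ((EuclideanSpace.proj (𝕜 := ℝ) j).continuous.tendsto _).comp hlim
      have h2 := h1.pow 2
      simpa using h2
    have h1 := ge_of_tendsto hlim2 (b := φ (γ t₀) j ^ 2) (by
      filter_upwards [eventually_le_atBot t₀] with t ht
      exact hanti ht self_mem_Iic ht)
    have h2 := hne t₀ (ht₀ t₀ le_rfl)
    have h3 : 0 < φ (γ t₀) j ^ 2 := by positivity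
    linarith
  obtain ⟨c, hc⟩ := Plane.exists_smul_of_area_eq_zero hd0
    (a := d) (b := α j) (by rw [Plane.area_swap, harea, neg_zero])
  have hc0 : 0 < c := by
    have hu := hγ.unit
    have : Plane.dot (α j) d = c := by
      rw [hc, Plane.dot]
      simp only [Prod.smul_fst, Prod.smul_snd, smul_eq_mul]
      linear_combination c * hu
    rwa [this] at hpos
  refine ⟨j, c, hc0, hc, huniq, ?_⟩
  have hsingle : ∀ y : EuclideanSpace ℝ (Fin n), (∀ i, i ≠ j → y i = 0) →
      y = y j • EuclideanSpace.single j (1 : ℝ) := by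
    intro y hy
    ext i
    rcases eq_or_ne i j with rfl | hij
    · simp
    · simp [hij, hy i hij]
  apply le_antisymm
  · rw [tangentLine, Submodule.span_le]
    intro y hy
    obtain ⟨ι, l, hl, a, b, -, hb, hab⟩ := exists_fun_of_mem_tangentConeAt hy
    have hclosed : IsClosed (Submodule.span ℝ {(EuclideanSpace.single j (1 : ℝ) :
      EuclideanSpace ℝ (Fin n))} : Set (EuclideanSpace ℝ (Fin n))) :=
      Submodule.closed_of_finiteDimensional _
    refine hclosed.mem_of_tendsto hab ?_
    filter_upwards [hb] with k hk
    rw [zero_add] at hk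
    obtain ⟨x, ⟨⟨t, rfl⟩, hx⟩, hxk⟩ := hk
    rw [← hxk, hsingle _ (hcoord t hx)]
    exact Submodule.smul_mem _ _ (Submodule.smul_mem _ _ (Submodule.mem_span_singleton_self _))
  · rw [Submodule.span_singleton_le_iff_mem, tangentLine]
    apply Submodule.subset_span
    -- The edge lies on the `j`-th axis, so the points rescaled by the inverse of their coordinate
    -- are constantly the basis vector.
    refine mem_tangentConeAt_of_seq atBot (fun t => (φ (γ t) j)⁻¹) (fun t => φ (γ t)) hlim ?_ ?_
    · filter_upwards [hev] with t ht
      rw [zero_add]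
      exact ⟨γ t, ⟨⟨t, rfl⟩, ht⟩, rfl⟩
    · refine tendsto_const_nhds.congr' ?_
      filter_upwards [hev] with t ht
      rw [eq_comm, inv_smul_eq_iff₀ (hne t ht)]
      exact hsingle _ (hcoord t ht)

end TwoMorse

end Edges

/-! ### Invariant sections over toric charts -/

section InvariantSections

variable {n : ℕ} {i j : Fin n}

/-- The coordinate plane in the directions `i` and `j`. -/
def coordPlane (i j : Fin n) : Submodule ℝ (EuclideanSpace ℝ (Fin n)) :=
  Submodule.span ℝ {EuclideanSpace.single i (1 : ℝ)} ⊔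
    Submodule.span ℝ {EuclideanSpace.single j (1 : ℝ)}

/-- The linear map which replaces the coordinates `i` and `j` by `0`. -/
def eraseCoords (i j : Fin n) : EuclideanSpace ℝ (Fin n) →ₗ[ℝ] EuclideanSpace ℝ (Fin n) where
  toFun X := WithLp.toLp 2 fun k => if k = i ∨ k = j then 0 else X k
  map_add' X Y := by ext k; by_cases h : k = i ∨ k = j <;> simp [h]
  map_smul' c X := by ext k; by_cases h : k = i ∨ k = j <;> simp [h]

theorem eraseCoords_apply (X : EuclideanSpace ℝ (Fin n)) (k : Fin n) :
    eraseCoords i j X k = if k = i ∨ k = j then 0 else X k := rfl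

theorem coordPlane_le_ker : coordPlane i j ≤ LinearMap.ker (eraseCoords i j) := by
  rw [coordPlane, sup_le_iff, Submodule.span_singleton_le_iff_mem,
    Submodule.span_singleton_le_iff_mem]
  constructor <;> rw [LinearMap.mem_ker] <;> ext k <;> rw [eraseCoords_apply] <;>
    by_cases h : k = i ∨ k = j <;> simp [h] <;> push Not at h
  · exact h.1
  · exact h.2

/-- The coordinates, other than `i` and `j`, on the quotient by a coordinate plane. -/
def normalCoords (i j : Fin n) :
    (EuclideanSpace ℝ (Fin n) ⧸ coordPlane i j) →ₗ[ℝ] EuclideanSpace ℝ (Fin n) :=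
  (coordPlane i j).liftQ (eraseCoords i j) coordPlane_le_ker

theorem normalCoords_mkQ (X : EuclideanSpace ℝ (Fin n)) (k : Fin n) :
    normalCoords i j ((coordPlane i j).mkQ X) k = if k = i ∨ k = j then 0 else X k := rfl

theorem normalCoords_eq_zero {z : EuclideanSpace ℝ (Fin n) ⧸ coordPlane i j}
    (h : ∀ k, normalCoords i j z k = 0) : z = 0 := by
  obtain ⟨X, rfl⟩ := (coordPlane i j).mkQ_surjective z
  rw [Submodule.mkQ_apply, Submodule.Quotient.mk_eq_zero]
  by_cases hij : i = j
  · subst hij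
    have : X = X i • EuclideanSpace.single i (1 : ℝ) := by
      ext k
      by_cases hk : k = i
      · subst hk; simp
      · have := h k
        rw [normalCoords_mkQ] at this
        simpa [hk] using this
    rw [this]
    exact Submodule.mem_sup_left (Submodule.smul_mem _ _ (Submodule.mem_span_singleton_self _))
  have : X = X i • EuclideanSpace.single i (1 : ℝ) + X j • EuclideanSpace.single j (1 : ℝ) := by
    ext k
    by_cases hk : k = i
    · subst hk; simp [hij]
    by_cases hk' : k = j
    · subst hk'; simp [hk]
    · have := h k
      rw [normalCoords_mkQ] at this
      simpa [hk, hk'] using this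
  rw [this]
  exact Submodule.add_mem_sup (Submodule.smul_mem _ _ (Submodule.mem_span_singleton_self _))
    (Submodule.smul_mem _ _ (Submodule.mem_span_singleton_self _))

theorem continuous_normalCoords : Continuous (normalCoords i j) := by
  refine continuous_quot_lift _ ?_
  exact LinearMap.continuous_of_finiteDimensional (eraseCoords i j)

theorem continuous_mkQ_coordPlane : Continuous (coordPlane i j).mkQ := continuous_quot_mk

variable {β₁ β₂ : Plane} {α : Fin n → Plane}

theorem dot_eq_of_area_ne_zero (h : Plane.area β₁ β₂ ≠ 0) (a t : Plane) :
    Plane.dot a t = Plane.area a β₂ / Plane.area β₁ β₂ * Plane.dot β₁ t +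
      Plane.area β₁ a / Plane.area β₁ β₂ * Plane.dot β₂ t := by
  field_simp
  simp only [Plane.dot, Plane.area]
  ring

theorem exists_dot_eq (h : Plane.area β₁ β₂ ≠ 0) (a b : ℝ) :
    ∃ t, Plane.dot β₁ t = a ∧ Plane.dot β₂ t = b := by
  refine ⟨((a * β₂.2 - b * β₁.2) / Plane.area β₁ β₂, (b * β₁.1 - a * β₂.1) / Plane.area β₁ β₂),
    ?_, ?_⟩ <;> simp only [Plane.dot] <;> field_simp <;> simp only [Plane.area] <;> ring

variable {I₁ I₂ : Set ℝ}

theorem normalCoords_invariant {s : ↥(I₁ ×ˢ I₂) → EuclideanSpace ℝ (Fin n) ⧸ coordPlane i j}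
    (hs : s ∈ invariantSections (I₁ ×ˢ I₂) β₁ β₂ α (coordPlane i j)) {t : Plane}
    {x y : ↥(I₁ ×ˢ I₂)} (h : (y : ℝ × ℝ) = toricAct β₁ β₂ t x) (k : Fin n) :
    normalCoords i j (s y) k = Real.exp (Plane.dot (α k) t) * normalCoords i j (s x) k := by
  obtain ⟨X, hX, hX'⟩ := hs.2 t x y h
  rw [← hX, ← hX', normalCoords_mkQ, normalCoords_mkQ]
  split_ifs
  · simp
  · rfl

/-- The open quadrant is a single orbit, so a section is determined there by its value at `(1, 1)`.
The exponents are the coordinates of `α k` in the basis `β₁, β₂`, by Cramer's rule. -/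
theorem normalCoords_eq_rpow (hβ : Plane.area β₁ β₂ ≠ 0) (h1 : Ioi 0 ⊆ I₁) (h2 : Ioi 0 ⊆ I₂)
    {s : ↥(I₁ ×ˢ I₂) → EuclideanSpace ℝ (Fin n) ⧸ coordPlane i j}
    (hs : s ∈ invariantSections (I₁ ×ˢ I₂) β₁ β₂ α (coordPlane i j)) {a b : ℝ} (ha : 0 < a)
    (hb : 0 < b) (k : Fin n) :
    normalCoords i j (s ⟨(a, b), h1 ha, h2 hb⟩) k =
      a ^ (Plane.area (α k) β₂ / Plane.area β₁ β₂) * b ^ (Plane.area β₁ (α k) / Plane.area β₁ β₂) *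
        normalCoords i j (s ⟨(1, 1), h1 (zero_lt_one' ℝ), h2 (zero_lt_one' ℝ)⟩) k := by
  obtain ⟨t, ht1, ht2⟩ := exists_dot_eq hβ (Real.log a) (Real.log b)
  rw [normalCoords_invariant hs (t := t)
    (x := ⟨(1, 1), h1 (zero_lt_one' ℝ), h2 (zero_lt_one' ℝ)⟩)]
  · rw [dot_eq_of_area_ne_zero hβ, ht1, ht2, Real.exp_add, Real.rpow_def_of_pos ha,
      Real.rpow_def_of_pos hb, mul_comm (Real.log a), mul_comm (Real.log b)]
  · simp [toricAct, ht1, ht2, Real.exp_log ha, Real.exp_log hb]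

open Classical in
/-- The invariant sections over a part of a toric chart are a sum of lines, one for each character
of the normal space which extends continuously. -/
theorem finrank_invariantSections (hβ : 0 < Plane.area β₁ β₂) (h1 : Ioi 0 ⊆ I₁) (h1' : I₁ ⊆ Ici 0)
    (h2 : Ioi 0 ⊆ I₂) (h2' : I₂ ⊆ Ici 0)
    (hα₁ : ∀ k, k ≠ j → Plane.area (α k) β₂ ≠ 0) (hα₂ : ∀ k, k ≠ i → Plane.area β₁ (α k) ≠ 0) :
    Module.finrank ℝ (invariantSections (I₁ ×ˢ I₂) β₁ β₂ α (coordPlane i j)) =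
      (Finset.univ.filter fun k => ¬ (k = i ∨ k = j) ∧ (0 ∈ I₁ → 0 < Plane.area (α k) β₂) ∧
        (0 ∈ I₂ → 0 < Plane.area β₁ (α k))).card := by
  set good : Fin n → Prop := fun k => ¬ (k = i ∨ k = j) ∧ (0 ∈ I₁ → 0 < Plane.area (α k) β₂) ∧
        (0 ∈ I₂ → 0 < Plane.area β₁ (α k)) with hgood
  set A : Fin n → ℝ := fun k => Plane.area (α k) β₂ / Plane.area β₁ β₂ with hA
  set B : Fin n → ℝ := fun k => Plane.area β₁ (α k) / Plane.area β₁ β₂ with hB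
  let one : ↥(I₁ ×ˢ I₂) := ⟨(1, 1), h1 (zero_lt_one' ℝ), h2 (zero_lt_one' ℝ)⟩
  let Φ : invariantSections (I₁ ×ˢ I₂) β₁ β₂ α (coordPlane i j) →ₗ[ℝ] ({k // good k} → ℝ) :=
    { toFun := fun s k => normalCoords i j (s.1 one) k.1
      map_add' := fun s r => by ext k; simp
      map_smul' := fun c s => by ext k; simp }
  have hrp : ∀ (s : invariantSections (I₁ ×ˢ I₂) β₁ β₂ α (coordPlane i j)) {a b : ℝ} (ha : 0 < a)
      (hb : 0 < b) (k : Fin n), normalCoords i j (s.1 ⟨(a, b), h1 ha, h2 hb⟩) k =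
        a ^ A k * b ^ B k * normalCoords i j (s.1 one) k :=
    fun s a b ha hb k => normalCoords_eq_rpow hβ.ne' h1 h2 s.2 ha hb k
  have hcont : ∀ (s : invariantSections (I₁ ×ˢ I₂) β₁ β₂ α (coordPlane i j)) (k : Fin n),
      Continuous fun x => normalCoords i j (s.1 x) k := fun s k =>
    (EuclideanSpace.proj (𝕜 := ℝ) k).continuous.comp (continuous_normalCoords.comp s.2.1)
  have hinj : Function.Injective Φ := by
    rw [← LinearMap.ker_eq_bot, LinearMap.ker_eq_bot']
    intro s hs
    have hone : ∀ k, normalCoords i j (s.1 one) k = 0 := by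
      intro k
      by_cases hk : k = i ∨ k = j
      · obtain ⟨X, hX⟩ := (coordPlane i j).mkQ_surjective (s.1 one)
        rw [← hX, normalCoords_mkQ, if_pos hk]
      by_cases hkg : good k
      · exact congrFun hs ⟨k, hkg⟩
      -- Zero exponents are excluded by `hα₁` and `hα₂`, so a character that is not good has a
      -- negative exponent on a boundary component belonging to the domain.
      have hcases : (0 ∈ I₁ ∧ A k < 0) ∨ (0 ∈ I₂ ∧ B k < 0) := by
        push Not at hk
        have e1 := hα₁ k hk.2
        have e2 := hα₂ k hk.1
        by_contra hcon
        push Not at hcon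
        apply hkg
        refine ⟨by tauto, fun h => ?_, fun h => ?_⟩
        · refine lt_of_le_of_ne ?_ e1.symm
          by_contra hc
          push Not at hc
          exact absurd (div_neg_of_neg_of_pos hc hβ) (not_lt.2 (hcon.1 h))
        · refine lt_of_le_of_ne ?_ e2.symm
          by_contra hc
          push Not at hc
          exact absurd (div_neg_of_neg_of_pos hc hβ) (not_lt.2 (hcon.2 h))
      -- Approach that boundary component. The coordinate is a negative power of `a` times a
      -- constant and has a finite limit; multiplied by the inverse power it tends to `0`, so the
      -- constant vanishes.
      rcases hcases with ⟨h0, hneg⟩ | ⟨h0, hneg⟩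
      · let path : ℝ → ↥(I₁ ×ˢ I₂) := fun a => if ha : a ∈ I₁ then ⟨(a, 1), ha, one.2.2⟩ else one
        have hpath : ∀ {a} (ha : a ∈ I₁), path a = ⟨(a, 1), ha, one.2.2⟩ := fun ha => dif_pos ha
        have hlim : Tendsto path (𝓝[>] 0) (𝓝 (path 0)) := by
          rw [tendsto_subtype_rng, hpath h0]
          have : Tendsto (fun a : ℝ => (a, (1 : ℝ))) (𝓝[>] 0) (𝓝 (0, 1)) :=
            (Continuous.tendsto (by fun_prop) 0).mono_left nhdsWithin_le_nhds
          refine this.congr' ?_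
          filter_upwards [self_mem_nhdsWithin] with a ha
          rw [hpath (h1 ha)]
        have l1 := ((hcont s k).tendsto (path 0)).comp hlim
        have l2 : Tendsto (fun a : ℝ => a ^ (-A k)) (𝓝[>] 0) (𝓝 0) := by
          have := ((Real.continuousAt_rpow_const 0 (-A k) (Or.inr (by linarith))).tendsto).mono_left
            (nhdsWithin_le_nhds (s := Ioi 0))
          rwa [Real.zero_rpow (by linarith)] at this
        have l3 := l2.mul l1
        rw [zero_mul] at l3
        refine tendsto_nhds_unique (tendsto_const_nhds.congr' ?_) l3
        filter_upwards [self_mem_nhdsWithin] with a ha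
        have ha' : (0 : ℝ) < a := ha
        simp only [Function.comp_apply]
        rw [hpath (h1 ha), hrp s ha' one_pos k, Real.one_rpow, mul_one, ← mul_assoc,
          ← Real.rpow_add ha', neg_add_cancel, Real.rpow_zero, one_mul]
      · let path : ℝ → ↥(I₁ ×ˢ I₂) := fun a => if ha : a ∈ I₂ then ⟨(1, a), one.2.1, ha⟩ else one
        have hpath : ∀ {a} (ha : a ∈ I₂), path a = ⟨(1, a), one.2.1, ha⟩ := fun ha => dif_pos ha
        have hlim : Tendsto path (𝓝[>] 0) (𝓝 (path 0)) := by
          rw [tendsto_subtype_rng, hpath h0]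
          have : Tendsto (fun a : ℝ => ((1 : ℝ), a)) (𝓝[>] 0) (𝓝 (1, 0)) :=
            (Continuous.tendsto (by fun_prop) 0).mono_left nhdsWithin_le_nhds
          refine this.congr' ?_
          filter_upwards [self_mem_nhdsWithin] with a ha
          rw [hpath (h2 ha)]
        have l1 := ((hcont s k).tendsto (path 0)).comp hlim
        have l2 : Tendsto (fun a : ℝ => a ^ (-B k)) (𝓝[>] 0) (𝓝 0) := by
          have := ((Real.continuousAt_rpow_const 0 (-B k) (Or.inr (by linarith))).tendsto).mono_left
            (nhdsWithin_le_nhds (s := Ioi 0))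
          rwa [Real.zero_rpow (by linarith)] at this
        have l3 := l2.mul l1
        rw [zero_mul] at l3
        refine tendsto_nhds_unique (tendsto_const_nhds.congr' ?_) l3
        filter_upwards [self_mem_nhdsWithin] with a ha
        have ha' : (0 : ℝ) < a := ha
        simp only [Function.comp_apply]
        rw [hpath (h2 ha), hrp s one_pos ha' k, Real.one_rpow, one_mul, ← mul_assoc,
          ← Real.rpow_add ha', neg_add_cancel, Real.rpow_zero, one_mul]
    ext x
    apply normalCoords_eq_zero
    intro k
    have hx1 : 0 ≤ x.1.1 := h1' x.2.1
    have hx2 : 0 ≤ x.1.2 := h2' x.2.2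
    -- Boundary points are limits of points of the open quadrant, where the section is already known
    -- to vanish.
    let path : ℝ → ↥(I₁ ×ˢ I₂) := fun a => if ha : 0 < a then
      ⟨(x.1.1 + a, x.1.2 + a), h1 (add_pos_of_nonneg_of_pos hx1 ha),
        h2 (add_pos_of_nonneg_of_pos hx2 ha)⟩ else x
    have hpath : ∀ {a} (ha : 0 < a), path a = ⟨(x.1.1 + a, x.1.2 + a),
      h1 (add_pos_of_nonneg_of_pos hx1 ha), h2 (add_pos_of_nonneg_of_pos hx2 ha)⟩ :=
      fun ha => dif_pos ha
    have hlim : Tendsto path (𝓝[>] 0) (𝓝 x) := by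
      rw [tendsto_subtype_rng]
      have : Tendsto (fun a : ℝ => (x.1.1 + a, x.1.2 + a)) (𝓝[>] 0) (𝓝 (x.1.1 + 0, x.1.2 + 0)) :=
        (Continuous.tendsto (by fun_prop) 0).mono_left nhdsWithin_le_nhds
      rw [add_zero, add_zero] at this
      refine this.congr' ?_
      filter_upwards [self_mem_nhdsWithin] with a ha
      rw [hpath ha]
    refine tendsto_nhds_unique (((hcont s k).tendsto x).comp hlim) (tendsto_const_nhds.congr' ?_)
    filter_upwards [self_mem_nhdsWithin] with a ha
    have ha' : (0 : ℝ) < a := ha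
    simp only [Function.comp_apply]
    rw [hpath ha', hrp s (add_pos_of_nonneg_of_pos hx1 ha') (add_pos_of_nonneg_of_pos hx2 ha') k,
      hone, mul_zero]
  have hsurj : Function.Surjective Φ := by
    intro c
    let V : ℝ × ℝ → EuclideanSpace ℝ (Fin n) := fun x => WithLp.toLp 2 fun k =>
      if h : good k then c ⟨k, h⟩ * x.1 ^ A k * x.2 ^ B k else 0
    have hV : ∀ x k, V x k = if h : good k then c ⟨k, h⟩ * x.1 ^ A k * x.2 ^ B k else 0 :=
      fun x k => rfl
    have hVc : Continuous fun x : ↥(I₁ ×ˢ I₂) => V x := by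
      refine (PiLp.continuous_toLp 2 _).comp (continuous_pi fun k => ?_)
      by_cases h : good k
      · simp only [h, dif_pos]
        have c1 : Continuous fun x : ↥(I₁ ×ˢ I₂) => x.1.1 ^ A k := by
          refine Continuous.rpow_const (by fun_prop) fun x => ?_
          by_cases h0 : 0 ∈ I₁
          · exact Or.inr (div_nonneg (h.2.1 h0).le hβ.le)
          · exact Or.inl fun hx => h0 (hx ▸ x.2.1)
        have c2 : Continuous fun x : ↥(I₁ ×ˢ I₂) => x.1.2 ^ B k := by
          refine Continuous.rpow_const (by fun_prop) fun x => ?_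
          by_cases h0 : 0 ∈ I₂
          · exact Or.inr (div_nonneg (h.2.2 h0).le hβ.le)
          · exact Or.inl fun hx => h0 (hx ▸ x.2.2)
        exact (continuous_const.mul c1).mul c2
      · simp only [h, dif_neg, not_false_eq_true]
        exact continuous_const
    refine ⟨⟨fun x => (coordPlane i j).mkQ (V x), continuous_mkQ_coordPlane.comp hVc, ?_⟩, ?_⟩
    · intro t x y hxy
      refine ⟨V x, rfl, ?_⟩
      congr 1
      ext k
      have hx1 : 0 ≤ x.1.1 := h1' x.2.1
      have hx2 : 0 ≤ x.1.2 := h2' x.2.2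
      change Real.exp (Plane.dot (α k) t) * V x k = V y k
      rw [hV, hV, hxy]
      split_ifs with h
      · simp only [toricAct]
        rw [Real.mul_rpow (Real.exp_nonneg _) hx1, Real.mul_rpow (Real.exp_nonneg _) hx2,
          ← Real.exp_mul, ← Real.exp_mul, dot_eq_of_area_ne_zero hβ.ne' (α k) t, Real.exp_add,
          mul_comm (Plane.area (α k) β₂ / _), mul_comm (Plane.area β₁ (α k) / _)]
        ring
      · simp
    · ext ⟨k, hk⟩
      change normalCoords i j ((coordPlane i j).mkQ (V (1, 1))) k = _
      rw [normalCoords_mkQ, if_neg hk.1, hV, dif_pos hk]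
      simp
  rw [(LinearEquiv.ofBijective Φ ⟨hinj, hsurj⟩).finrank_eq, Module.finrank_fintype_fun_eq_card,
    Fintype.card_subtype]

end InvariantSections

/-! ### The expected dimension as a count of characters -/

section Frames

variable {n : ℕ} {M : Type*} [TopologicalSpace M] [ChartedSpace (EuclideanSpace ℝ (Fin n)) M]
  [IsManifold (𝓡 n) ∞ M]

namespace TwoMorse

variable {D : TwoMorse n M}

open Classical in
/-- The number of characters at `p` to the left of the direction `d`. -/
noncomputable def leftCount (D : TwoMorse n M) (p : D.CriticalPoint) (d : Plane) : ℕ :=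
  (Finset.univ.filter fun k => 0 < Plane.area d (D.weight p k)).card

/-- An edge has the same number of transverse characters of either sign at its two ends. -/
theorem IsEdge.leftCount_add {e : Set M} {p q : D.CriticalPoint} {d : Plane}
    (h : D.IsEdge e p q d) : (D.leftCount p d : ℤ) + D.leftCount q (-d) = n - 1 := by
  classical
  obtain ⟨j, c, hc, hj, huniq, -⟩ := h.exists_weight
  -- Left of `-d` means right of `d`, and the number of characters there can be computed at `p`
  -- instead of `q`. At `p`, only the character tangent to the edge lies on neither side.
  have h1 : D.leftCount q (-d) =
      (Finset.univ.filter fun k => 0 < Plane.area (D.weight p k) d).card := by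
    rw [card_pos_eq_of_sum_pow_eq (D.sum_pow_eq_of_isEdge h), leftCount]
    simp only [Plane.area_neg_left, Plane.area_swap d, neg_neg]
  have h2 : Finset.univ.filter (fun k => 0 < Plane.area d (D.weight p k)) ∪
      Finset.univ.filter (fun k => 0 < Plane.area (D.weight p k) d) = Finset.univ.erase j := by
    ext k
    simp only [Finset.mem_union, Finset.mem_filter, Finset.mem_univ, true_and, Finset.mem_erase,
      and_true, Plane.area_swap d]
    constructor
    · rintro h3 rfl
      rw [hj, Plane.area_smul_left, Plane.area_self] at h3
      simp at h3
    · intro hk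
      rcases lt_or_gt_of_ne (huniq k hk) with h3 | h3
      · left; linarith
      · right; exact h3
  have h3 : Disjoint (Finset.univ.filter (fun k => 0 < Plane.area d (D.weight p k)))
      (Finset.univ.filter (fun k => 0 < Plane.area (D.weight p k) d)) := by
    rw [Finset.disjoint_filter]
    intro k _ hk hk'
    rw [Plane.area_swap] at hk
    linarith
  have h4 := Finset.card_union_of_disjoint h3
  rw [h2, Finset.card_erase_of_mem (Finset.mem_univ j), Finset.card_univ, Fintype.card_fin] at h4
  have hn : 0 < n := j.pos
  rw [h1, leftCount]
  omega

namespace Frame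

theorem area_prev_pos (g : D.Frame) (a : Fin (g.size + 3)) :
    0 < Plane.area (g.dir (a - 1)) (g.dir a) := by
  have := (g.cyclic (a - 1)).1
  rwa [sub_add_cancel] at this

theorem isEdge_prev (g : D.Frame) (a : Fin (g.size + 3)) :
    D.IsEdge (g.edge (a - 1)) (g.vertex a) (g.vertex (a - 1)) (-g.dir (a - 1)) := by
  have := (g.isEdge (a - 1)).reverse
  rwa [sub_add_cancel] at this

open Classical in
/-- The number of characters at the `a`-th vertex in the half-open cone of the frame. -/
noncomputable def cornerCount (g : D.Frame) (a : Fin (g.size + 3)) : ℕ :=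
  (Finset.univ.filter fun k =>
    Plane.InSector (g.dir a) (-g.dir (a - 1)) (D.weight (g.vertex a) k)).card

/-- The two tangent characters do not contribute to the normal space. In the half-open corner cone
only the one along edge `a` was counted; to the left of edge `a`, only the one along edge `a - 1`;
over the open part both are removed. -/
theorem finrank_normalSections (g : D.Frame) (a : Fin (g.size + 3)) :
    (Module.finrank ℝ (g.normalSections a (Ici 0 ×ˢ Ici 0)) : ℤ) = g.cornerCount a - 1 ∧
    (Module.finrank ℝ (g.normalSections a (Ioi 0 ×ˢ Ici 0)) : ℤ) =
      D.leftCount (g.vertex a) (g.dir a) - 1 ∧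
    (Module.finrank ℝ (g.normalSections a (Ioi 0 ×ˢ Ioi 0)) : ℤ) = n - 2 := by
  classical
  obtain ⟨i, c, hc, hi, hi', hTi⟩ := (g.isEdge a).exists_weight
  obtain ⟨j, b, hb, hj, hj', hTj⟩ := (g.isEdge_prev a).exists_weight
  have harea := g.area_prev_pos a
  have hβ : 0 < Plane.area (g.dir a) (-g.dir (a - 1)) := by
    rwa [Plane.area_neg_right, ← Plane.area_swap]
  have hT : g.leafTangent a = coordPlane i j := by rw [leafTangent, hTi, hTj]; rfl
  have hij : i ≠ j := by
    rintro rfl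
    have h1 := hi.symm.trans hj
    have h2 : Plane.area (g.dir (a - 1)) (c • g.dir a) = 0 := by
      rw [h1, Plane.area_smul_right, Plane.area_neg_right, Plane.area_self]; simp
    rw [Plane.area_smul_right] at h2
    exact (mul_pos hc harea).ne' h2
  have hα₂ : ∀ k, k ≠ i → Plane.area (g.dir a) (D.weight (g.vertex a) k) ≠ 0 := fun k hk => by
    rw [Plane.area_swap]; exact neg_ne_zero.2 (hi' k hk)
  have hflip : ∀ u, Plane.area u (-g.dir (a - 1)) = Plane.area (g.dir (a - 1)) u := fun u => by
    rw [Plane.area_neg_right, ← Plane.area_swap]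
  have hii : Plane.area (g.dir a) (D.weight (g.vertex a) i) = 0 := by
    rw [hi, Plane.area_smul_right, Plane.area_self, mul_zero]
  have hji : 0 < Plane.area (g.dir (a - 1)) (D.weight (g.vertex a) i) := by
    rw [hi, Plane.area_smul_right]; exact mul_pos hc harea
  have hjj : Plane.area (g.dir (a - 1)) (D.weight (g.vertex a) j) = 0 := by
    rw [hj, Plane.area_smul_right, Plane.area_neg_right, Plane.area_self, neg_zero, mul_zero]
  have hij' : 0 < Plane.area (g.dir a) (D.weight (g.vertex a) j) := by
    rw [hj, Plane.area_smul_right]; exact mul_pos hb hβ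
  have hfin : ∀ (I₁ I₂ : Set ℝ) (s : Finset (Fin n)), Ioi 0 ⊆ I₁ → I₁ ⊆ Ici 0 → Ioi 0 ⊆ I₂ →
      I₂ ⊆ Ici 0 → (∀ k, k ∈ s ↔ ¬ (k = i ∨ k = j) ∧
        (0 ∈ I₁ → 0 < Plane.area (g.dir (a - 1)) (D.weight (g.vertex a) k)) ∧
        (0 ∈ I₂ → 0 < Plane.area (g.dir a) (D.weight (g.vertex a) k))) →
      Module.finrank ℝ (g.normalSections a (I₁ ×ˢ I₂)) = s.card := by
    intro I₁ I₂ s h1 h1' h2 h2' hs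
    have := finrank_invariantSections (α := D.weight (g.vertex a)) hβ h1 h1' h2 h2'
      (fun k hk => hj' k hk) hα₂
    simp only [hflip] at this
    rw [normalSections, hT]
    refine this.trans (congrArg _ ?_)
    ext k
    simp [hs]
  refine ⟨?_, ?_, ?_⟩
  · have hmem : i ∈ Finset.univ.filter fun k => Plane.InSector (g.dir a) (-g.dir (a - 1))
        (D.weight (g.vertex a) k) := by
      simp [Plane.InSector, hflip, hii, hji]
    rw [hfin _ _ ((Finset.univ.filter fun k => Plane.InSector (g.dir a) (-g.dir (a - 1))
      (D.weight (g.vertex a) k)).erase i) Ioi_subset_Ici_self subset_rfl Ioi_subset_Ici_self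
      subset_rfl, Finset.cast_card_erase_of_mem hmem, cornerCount]
    intro k
    simp only [Plane.InSector, hflip, Finset.mem_filter, Finset.mem_univ, true_and,
      Finset.mem_erase, self_mem_Ici, forall_const]
    rcases eq_or_ne k i with rfl | hki
    · simp
    rcases eq_or_ne k j with rfl | hkj
    · simp [hjj]
    simp only [hki, hkj, or_self, not_false_eq_true, true_and, ne_eq]
    rw [and_comm, le_iff_lt_or_eq, or_iff_left (hα₂ k hki).symm]
  · have hmem : j ∈ Finset.univ.filter fun k => 0 < Plane.area (g.dir a)
        (D.weight (g.vertex a) k) := by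
      simp [hij']
    rw [hfin _ _ ((Finset.univ.filter fun k => 0 < Plane.area (g.dir a)
      (D.weight (g.vertex a) k)).erase j) subset_rfl Ioi_subset_Ici_self Ioi_subset_Ici_self
      subset_rfl, Finset.cast_card_erase_of_mem hmem, leftCount]
    intro k
    simp only [Finset.mem_filter, Finset.mem_univ, true_and, Finset.mem_erase, self_mem_Ici,
      forall_const, mem_Ioi, lt_self_iff_false, false_imp_iff]
    rcases eq_or_ne k i with rfl | hki
    · simp [hii]
    simp [hki]
  · rw [hfin _ _ ((Finset.univ.erase i).erase j) subset_rfl Ioi_subset_Ici_self subset_rfl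
      Ioi_subset_Ici_self (by intro k; simp [and_comm]),
      Finset.cast_card_erase_of_mem (by simp [hij.symm]),
      Finset.cast_card_erase_of_mem (Finset.mem_univ i), Finset.card_univ, Fintype.card_fin]
    ring

theorem expectedDim_eq (g : D.Frame) : g.expectedDim =
    ∑ a, (g.cornerCount a : ℤ) - ∑ a, (D.leftCount (g.vertex a) (g.dir a) : ℤ) + (n - 2) := by
  rw [expectedDim, (g.finrank_normalSections 0).2.2,
    Finset.sum_congr rfl fun a _ => (g.finrank_normalSections a).1,
    Finset.sum_congr rfl fun a _ => (g.finrank_normalSections a).2.1,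
    Finset.sum_sub_distrib, Finset.sum_sub_distrib]
  ring

/-- The sum over the boundary of a frame of a function of the pairs of a vertex and the direction of
an edge starting there. -/
def boundarySum (G : D.CriticalPoint → Plane → ℤ) (g : D.Frame) : ℤ :=
  ∑ a, (G (g.vertex a) (g.dir a) - G (g.vertex a) (-g.dir (a - 1)))

/-- Regrouped by edges instead of corners, each term changes sign when its edge is reversed. -/
theorem boundarySum_eq (G : D.CriticalPoint → Plane → ℤ) (g : D.Frame) :
    g.boundarySum G = ∑ a, (G (g.vertex a) (g.dir a) - G (g.vertex (a + 1)) (-g.dir a)) := by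
  rw [boundarySum, Finset.sum_sub_distrib, Finset.sum_sub_distrib]
  congr 1
  rw [← Equiv.sum_comp (Equiv.addRight (1 : Fin (g.size + 3)))]
  simp

open Classical in
/-- The number of corners of a frame that contain the cut of the angle function. -/
noncomputable def wrapCount (g : D.Frame) : ℤ :=
  ∑ a, if Plane.angle (-g.dir (a - 1)) < Plane.angle (g.dir a) then 1 else 0

open Classical in
theorem indicator_corner (g : D.Frame) (a : Fin (g.size + 3)) {u : Plane} (hu : u ≠ 0) :
    (if Plane.InSector (g.dir a) (-g.dir (a - 1)) u then (1 : ℤ) else 0) =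
      (if Plane.angle (g.dir a) ≤ Plane.angle u then 1 else 0)
      - (if Plane.angle (-g.dir (a - 1)) ≤ Plane.angle u then 1 else 0)
      + (if Plane.angle (-g.dir (a - 1)) < Plane.angle (g.dir a) then 1 else 0) := by
  refine Plane.indicator_inSector ?_ hu
  rw [Plane.area_neg_right, ← Plane.area_swap]
  exact g.area_prev_pos a

-- The correction for the cut does not depend on the character, so each corner that needs it
-- contributes `n`.
open Classical in
theorem sum_cornerCount (g : D.Frame) : ∑ a, (g.cornerCount a : ℤ) =
    g.boundarySum (fun p d => ∑ k, if Plane.angle d ≤ Plane.angle (D.weight p k) then 1 else 0)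
      + n * g.wrapCount := by
  have h : ∀ a, (g.cornerCount a : ℤ) = ∑ k,
      ((if Plane.angle (g.dir a) ≤ Plane.angle (D.weight (g.vertex a) k) then (1 : ℤ) else 0)
      - (if Plane.angle (-g.dir (a - 1)) ≤ Plane.angle (D.weight (g.vertex a) k) then 1 else 0)
      + (if Plane.angle (-g.dir (a - 1)) < Plane.angle (g.dir a) then 1 else 0)) := by
    intro a
    rw [cornerCount, Finset.card_filter]
    push_cast
    refine Finset.sum_congr rfl fun k _ => ?_
    exact g.indicator_corner a (weight_ne_zero (D.isLinearization (g.vertex a))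
      (g.vertex a).2.1 (g.vertex a).2.2 k)
  rw [Finset.sum_congr rfl fun a _ => h a, boundarySum, wrapCount, Finset.mul_sum,
    ← Finset.sum_add_distrib]
  refine Finset.sum_congr rfl fun a _ => ?_
  rw [Finset.sum_add_distrib, Finset.sum_sub_distrib, Finset.sum_const, Finset.card_univ,
    Fintype.card_fin, nsmul_eq_mul]

-- Apply the splitting of corner indicators to both rays of a test line; the total is known, since a
-- line meets all but two corners. Thus the wrap count is a boundary sum plus a term depending only
-- on the number of vertices.
open Classical in
theorem two_mul_wrapCount (g : D.Frame) (u : Plane) (hu : u ≠ 0) : ((g.size + 3 : ℕ) : ℤ) - 2 =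
    g.boundarySum (fun _ d => (if Plane.angle d ≤ Plane.angle u then 1 else 0) +
      (if Plane.angle d ≤ Plane.angle (-u) then 1 else 0)) + 2 * g.wrapCount := by
  rw [← Plane.sum_indicator_corner g.fan g.cyclic hu, boundarySum, wrapCount, Finset.mul_sum,
    ← Finset.sum_add_distrib]
  refine Finset.sum_congr rfl fun a _ => ?_
  rw [g.indicator_corner a hu, g.indicator_corner a (neg_ne_zero.2 hu)]
  ring

/-- `IsEdge.leftCount_add` eliminates the left count at the far end of each edge, so the sum of left
counts is, up to a constant, half of a boundary sum. -/
theorem boundarySum_leftCount (g : D.Frame) : g.boundarySum (fun p d => (D.leftCount p d : ℤ)) =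
    2 * ∑ a, (D.leftCount (g.vertex a) (g.dir a) : ℤ) - (g.size + 3 : ℕ) * (n - 1) := by
  have h : ∀ a, (D.leftCount (g.vertex a) (g.dir a) : ℤ) - D.leftCount (g.vertex (a + 1)) (-g.dir a)
      = 2 * (D.leftCount (g.vertex a) (g.dir a) : ℤ) - (n - 1) := by
    intro a
    have := (g.isEdge a).leftCount_add
    linarith
  rw [boundarySum_eq, Finset.sum_congr rfl fun a _ => h a, Finset.sum_sub_distrib, Finset.mul_sum,
    Finset.sum_const, Finset.card_univ, Fintype.card_fin, nsmul_eq_mul]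

end Frame

/-! ### Additivity over the pieces of a subdivision -/

namespace Subdivision

variable {f : D.Frame} {k : ℕ}

/-- As the sides of a subdivision are glued in pairs, the boundary sums are additive. -/
theorem sum_boundarySum (S : Subdivision f k) (G : D.CriticalPoint → Plane → ℤ) :
    ∑ i, (S.piece i).boundarySum G = f.boundarySum G := by
  -- Reindexing by `twin` reverses every side. The outer sides carry the reversed edges of `f`,
  -- which puts `f` on the other side of the resulting identity.
  have h : ∑ x : Side f S.piece, G x.tail x.dir = ∑ x : Side f S.piece, G x.head (-x.dir) := by
    rw [← Equiv.sum_comp (⟨S.twin, S.twin, S.twin_twin, S.twin_twin⟩ : Side f S.piece ≃ _)]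
    simp [S.tail_twin, S.dir_twin]
  rw [Fintype.sum_sum_type, Fintype.sum_sum_type, Fintype.sum_sigma, Fintype.sum_sigma] at h
  simp only [Side.tail, Side.head, Side.dir, neg_neg] at h
  simp only [Frame.boundarySum_eq, Finset.sum_sub_distrib]
  linarith

/-- Twice the expected dimension of a frame with `m` vertices is a boundary sum plus `m - 4`, and
the boundary sums cancel. The test line through `(1, 0)` is arbitrary, but must be the same for all
frames. -/
theorem two_mul_expectedCodim (S : Subdivision f k) : 2 * S.expectedCodim =
    4 * ((k : ℤ) - 1) - (∑ i, (((S.piece i).size + 3 : ℕ) : ℤ) - (f.size + 3 : ℕ)) := by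
  classical
  have hu : ((1, 0) : Plane) ≠ 0 := by simp
  have h1 := S.sum_boundarySum
    (fun p d => ∑ k, if Plane.angle d ≤ Plane.angle (D.weight p k) then 1 else 0)
  have h2 := S.sum_boundarySum
    (fun _ d => (if Plane.angle d ≤ Plane.angle ((1, 0) : Plane) then 1 else 0) +
      (if Plane.angle d ≤ Plane.angle (-((1, 0) : Plane)) then 1 else 0))
  have h3 := S.sum_boundarySum (fun p d => (D.leftCount p d : ℤ))
  have e1 := f.sum_cornerCount
  have e2 := f.two_mul_wrapCount (1, 0) hu
  have e3 := f.boundarySum_leftCount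
  have s1 := Finset.sum_congr rfl fun i (_ : i ∈ Finset.univ) => (S.piece i).sum_cornerCount
  have s2 := Finset.sum_congr rfl fun i (_ : i ∈ Finset.univ) =>
    (S.piece i).two_mul_wrapCount (1, 0) hu
  have s3 := Finset.sum_congr rfl fun i (_ : i ∈ Finset.univ) => (S.piece i).boundarySum_leftCount
  rw [Finset.sum_add_distrib, ← Finset.mul_sum] at s1 s2
  rw [Finset.sum_sub_distrib, Finset.sum_const, Finset.card_univ, Fintype.card_fin,
    nsmul_eq_mul] at s2
  rw [Finset.sum_sub_distrib, ← Finset.mul_sum, ← Finset.sum_mul] at s3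
  rw [expectedCodim, f.expectedDim_eq,
    Finset.sum_congr rfl fun i _ => (S.piece i).expectedDim_eq, Finset.sum_add_distrib,
    Finset.sum_sub_distrib, Finset.sum_const, Finset.card_univ, Fintype.card_fin, nsmul_eq_mul]
  rw [h1] at s1
  rw [h2] at s2
  rw [h3] at s3
  linear_combination (-2) * s1 + 2 * e1 + (n : ℤ) * s2 - (n : ℤ) * e2 - s3 + e3

end Subdivision

end TwoMorse

end Frames

/-! ### Polygons on the two sides of an edge -/

namespace Plane

theorem eq_or_eq_neg_of_unit {a b : Plane} (ha : a.1 ^ 2 + a.2 ^ 2 = 1) (hb : b.1 ^ 2 + b.2 ^ 2 = 1)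
    (h : area a b = 0) : b = a ∨ b = -a := by
  obtain ⟨c, rfl⟩ := exists_smul_of_area_eq_zero (by rintro rfl; norm_num at ha) h
  simp only [Prod.smul_fst, Prod.smul_snd, smul_eq_mul] at hb
  have hc : c ^ 2 = 1 := by linear_combination hb - c ^ 2 * ha
  rcases mul_self_eq_one_iff.1 ((sq c).symm.trans hc) with rfl | rfl
  · left; simp
  · right; simp

/-- A convex set which contains a segment and a point to the left of it contains a strip along the
segment. -/
theorem exists_strip_subset {K : Set Plane} (hK : Convex ℝ K) {p r d : Plane} {l : ℝ} (hl : 0 < l)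
    (hd : d.1 ^ 2 + d.2 ^ 2 = 1) (hp : p ∈ K) (hq : p + l • d ∈ K) (hr : r ∈ K)
    (h : 0 < area d (r - p)) : ∃ δ > 0, ∀ x, l / 4 < dot d (x - p) → dot d (x - p) < 3 * l / 4 →
      0 < area d (x - p) → area d (x - p) < δ → x ∈ K := by
  set b := area d (r - p) with hb
  set a := dot d (r - p) / l with ha
  -- The barycentric coordinates of `x` with respect to `p`, `r`, `p + l • d` are found in `hx`. The
  -- width makes the contribution of `r` to the other two less than `1/4`, so they stay nonnegative
  -- over the middle half of the segment.
  refine ⟨b / (4 * (|a| + 1)), by positivity, fun x h1 h2 h3 h4 => ?_⟩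
  set σ := dot d (x - p) with hσ
  set τ := area d (x - p) with hτ
  have hτb : τ / b * (|a| + 1) < 1 / 4 := by
    rw [lt_div_iff₀ (by positivity)] at h4
    rw [div_mul_eq_mul_div, div_lt_iff₀ h]
    linarith
  have hτ0 : 0 < τ / b := div_pos h3 h
  have hτa : |τ / b * a| ≤ τ / b * |a| := by rw [abs_mul, abs_of_pos hτ0]
  have hτa' := abs_le.1 hτa
  have hσ1 : 1 / 4 < σ / l := by rw [lt_div_iff₀ hl]; linarith
  have hσ2 : σ / l < 3 / 4 := by rw [div_lt_iff₀ hl]; linarith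
  have hx : x = (1 - τ / b - (σ / l - τ / b * a)) • p + (τ / b) • r +
      (σ / l - τ / b * a) • (p + l • d) := by
    have decomp : ∀ y : Plane, y.1 - p.1 = dot d (y - p) * d.1 - area d (y - p) * d.2 ∧
        y.2 - p.2 = dot d (y - p) * d.2 + area d (y - p) * d.1 := by
      intro y
      simp only [dot, area, Prod.fst_sub, Prod.snd_sub]
      constructor
      · linear_combination (-(y.1 - p.1)) * hd
      · linear_combination (-(y.2 - p.2)) * hd
    have e1 : τ / b * b = τ := div_mul_cancel₀ _ h.ne'
    have e2 : σ / l * l = σ := div_mul_cancel₀ _ hl.ne'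
    have e3 : a * l = dot d (r - p) := div_mul_cancel₀ _ hl.ne'
    obtain ⟨x1, x2⟩ := decomp x
    obtain ⟨r1, r2⟩ := decomp r
    rw [← hσ, ← hτ] at x1 x2
    rw [← hb, ← e3] at r1 r2
    clear_value σ τ a b
    refine Prod.ext ?_ ?_
    · simp only [Prod.fst_add, Prod.smul_fst, smul_eq_mul]
      linear_combination x1 - τ / b * r1 - d.1 * e2 + d.2 * e1
    · simp only [Prod.snd_add, Prod.smul_snd, smul_eq_mul]
      linear_combination x2 - τ / b * r2 - d.2 * e2 - d.1 * e1
  rw [hx]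
  have hmul : τ / b * (|a| + 1) = τ / b * |a| + τ / b := by ring
  have habs : 0 ≤ τ / b * |a| := by positivity
  have w1 : 0 ≤ 1 - τ / b - (σ / l - τ / b * a) := by linarith
  have w3 : 0 ≤ σ / l - τ / b * a := by linarith
  have := hK.sum_mem (t := Finset.univ) (w := ![1 - τ / b - (σ / l - τ / b * a), τ / b,
    σ / l - τ / b * a]) (z := ![p, r, p + l • d]) (by
      intro i _; fin_cases i
      exacts [w1, hτ0.le, w3]) (by simp [Fin.sum_univ_three]; ring) (by
      intro i _; fin_cases i
      exacts [hp, hr, hq])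
  simpa [Fin.sum_univ_three] using this

end Plane

section Frames

variable {n : ℕ} {M : Type*} [TopologicalSpace M] [ChartedSpace (EuclideanSpace ℝ (Fin n)) M]
  [IsManifold (𝓡 n) ∞ M]

namespace TwoMorse

variable {D : TwoMorse n M} {e : Set M} {p q p' q' : D.CriticalPoint} {d d' : Plane}

theorem IsEdge.unit (h : D.IsEdge e p q d) : d.1 ^ 2 + d.2 ^ 2 = 1 := by
  obtain ⟨γ, hγ, -⟩ := h
  exact hγ.unit

/-- An edge determines its direction up to its orientation. -/
theorem IsEdge.dir_eq_or (h : D.IsEdge e p q d) (h' : D.IsEdge e p' q' d') : d' = d ∨ d' = -d := by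
  refine Plane.eq_or_eq_neg_of_unit h.unit h'.unit ?_
  obtain ⟨γ, hγ, rfl, -⟩ := h
  obtain ⟨γ', hγ', hr, -⟩ := h'
  obtain ⟨t, ht⟩ : γ 0 ∈ range γ' := hr ▸ mem_range_self 0
  have h0 := field_eq_zero hγ' t
  rw [ht, field] at h0
  obtain ⟨hv, hw⟩ := smul_field hγ.unit (field_eq_zero hγ 0)
  rw [hv, hw, smul_smul, smul_smul, ← add_smul] at h0
  rcases smul_eq_zero.1 h0 with h1 | h1
  · rw [Plane.area]; linarith
  · exact absurd h1 (hγ.moving 0)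

/-- An oriented edge determines the projection of its starting point. -/
theorem IsEdge.proj_tail_eq (h : D.IsEdge e p q d) (h' : D.IsEdge e p' q' d) :
    D.proj p.1 = D.proj p'.1 := by
  have hu := h.unit
  obtain ⟨γ, hγ, rfl, hp, -⟩ := h
  obtain ⟨γ', hγ', hr, hp', -⟩ := h'
  have cv := D.smooth_fv.continuous
  have cw := D.smooth_fw.continuous
  have c1 : Continuous fun x => d.1 * D.fv x + d.2 * D.fw x := by fun_prop
  have c2 : Continuous fun x => d.2 * D.fv x - d.1 * D.fw x := by fun_prop
  -- Along `d`, the projected starting point is the infimum of a function over the edge; across `d`,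
  -- it is the constant value of another. Both depend only on the edge as a set.
  have g1 := isGLB_of_tendsto_atBot (strictMono_edge hγ).monotone ((c1.tendsto p.1).comp hp)
  have g2 := isGLB_of_tendsto_atBot (strictMono_edge hγ').monotone ((c1.tendsto p'.1).comp hp')
  have hrange : ∀ F : M → ℝ, (range fun s => F (γ s)) = range fun s => F (γ' s) := by
    intro F
    have e1 : (range fun s => F (γ s)) = F '' range γ := range_comp F γ
    have e2 : (range fun s => F (γ' s)) = F '' range γ' := range_comp F γ'
    rw [e1, e2, hr]
  rw [hrange fun x => d.1 * D.fv x + d.2 * D.fw x] at g1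
  have h1 := g1.unique g2
  obtain ⟨t, ht⟩ : γ 0 ∈ range γ' := hr ▸ mem_range_self 0
  have h5 : d.2 * D.fv p.1 - d.1 * D.fw p.1 = d.2 * D.fv (γ 0) - d.1 * D.fw (γ 0) :=
    tendsto_nhds_unique ((c2.tendsto p.1).comp hp) (by
      simp only [Function.comp_def, fun t => edge_const hγ t 0]
      exact tendsto_const_nhds)
  have h6 : d.2 * D.fv p'.1 - d.1 * D.fw p'.1 = d.2 * D.fv (γ 0) - d.1 * D.fw (γ 0) := by
    rw [← ht]
    exact tendsto_nhds_unique ((c2.tendsto p'.1).comp hp') (by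
      simp only [Function.comp_def, fun s => edge_const hγ' s t]
      exact tendsto_const_nhds)
  refine Prod.ext ?_ ?_
  · simp only [proj]
    linear_combination d.1 * h1 + d.2 * (h5 - h6) - (D.fv p.1 - D.fv p'.1) * hu
  · simp only [proj]
    linear_combination d.2 * h1 - d.1 * (h5 - h6) - (D.fw p.1 - D.fw p'.1) * hu

namespace Frame

theorem proj_mem_polygon (g : D.Frame) (a : Fin (g.size + 3)) :
    D.proj (g.vertex a).1 ∈ g.polygon :=
  subset_convexHull ℝ _ (mem_range_self a)

/-- The polygon of a frame has points to the left of each of its sides. -/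
theorem exists_left_mem_polygon (g : D.Frame) (a : Fin (g.size + 3)) :
    ∃ r ∈ g.polygon, 0 < Plane.area (g.dir a) (r - D.proj (g.vertex a).1) := by
  obtain ⟨l, hl, h1⟩ := (g.isEdge a).proj_eq
  obtain ⟨l', hl', h2⟩ := (g.isEdge (a + 1)).proj_eq
  -- The next edge turns left, so its end point lies strictly to the left.
  refine ⟨_, g.proj_mem_polygon (a + 1 + 1), ?_⟩
  rw [h2, h1, add_assoc, add_sub_cancel_left, Plane.area_add_right, Plane.area_smul_right,
    Plane.area_smul_right, Plane.area_self, mul_zero, zero_add]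
  exact mul_pos hl' (g.cyclic a).1

/-- The polygon of a frame lies to the left of each of its sides. -/
theorem area_nonneg_of_mem_polygon (g : D.Frame) (b : Fin (g.size + 3)) {x : Plane}
    (hx : x ∈ g.polygon) : 0 ≤ Plane.area (g.dir b) (x - D.proj (g.vertex b).1) := by
  set P : Fin (g.size + 3) → Plane := fun c => D.proj (g.vertex c).1 with hP
  have hstep : ∀ c, ∃ l : ℝ, 0 < l ∧ P (c + 1) = P c + l • g.dir c := fun c => (g.isEdge c).proj_eq
  have hmin : ∀ c, Plane.area (g.dir b) (P b) ≤ Plane.area (g.dir b) (P c) := by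
    -- At a vertex `c` minimizing the linear form, `dir b` turns neither before `dir (c - 1)` nor
    -- beyond `dir c`. No ray of the fan lies strictly between these two, so `b` is `c - 1` or `c`,
    -- and the form takes its minimum at vertex `b` as well.
    obtain ⟨c, -, hc⟩ := Finset.exists_min_image Finset.univ
      (fun c => Plane.area (g.dir b) (P c)) ⟨b, Finset.mem_univ b⟩
    suffices h : Plane.area (g.dir b) (P b) = Plane.area (g.dir b) (P c) by
      intro c'
      rw [h]
      exact hc c' (Finset.mem_univ _)
    have hpos := g.area_prev_pos c
    have h1 : 0 ≤ Plane.area (g.dir b) (g.dir c) := by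
      obtain ⟨l, hl, h⟩ := hstep c
      have := hc (c + 1) (Finset.mem_univ _)
      rw [h, Plane.area_add_right, Plane.area_smul_right] at this
      by_contra hcon
      push Not at hcon
      nlinarith
    have h2 : 0 ≤ Plane.area (g.dir (c - 1)) (g.dir b) := by
      obtain ⟨l, hl, h⟩ := hstep (c - 1)
      rw [sub_add_cancel] at h
      have := hc (c - 1) (Finset.mem_univ _)
      rw [h, Plane.area_add_right, Plane.area_smul_right] at this
      rw [Plane.area_swap]
      by_contra hcon
      push Not at hcon
      nlinarith
    rcases h1.lt_or_eq with h1 | h1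
    · rcases h2.lt_or_eq with h2 | h2
      · have h3 := (g.cyclic (c - 1)).2 b
        rw [sub_add_cancel] at h3
        exact absurd ⟨h2, h1⟩ h3
      · obtain ⟨r, hr⟩ := Plane.exists_smul_of_area_eq_zero (g.fan.ne_zero b)
          (b := g.dir (c - 1)) (by rw [Plane.area_swap, ← h2, neg_zero])
        rw [hr, Plane.area_smul_left] at hpos
        have hr0 : 0 ≤ r := by
          by_contra hcon
          push Not at hcon
          nlinarith
        have hb : b = c - 1 := g.fan.distinct _ _ (by
          rw [hr]; exact SameRay.sameRay_nonneg_smul_right _ hr0)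
        obtain ⟨l, hl, h⟩ := hstep b
        rw [show c = b + 1 by rw [hb, sub_add_cancel], h, Plane.area_add_right,
          Plane.area_smul_right, Plane.area_self, mul_zero, add_zero]
    · obtain ⟨r, hr⟩ := Plane.exists_smul_of_area_eq_zero (g.fan.ne_zero b) h1.symm
      rw [hr, Plane.area_smul_right] at hpos
      have hr0 : 0 ≤ r := by
        by_contra hcon
        push Not at hcon
        nlinarith
      have hb : b = c := g.fan.distinct _ _ (by
        rw [hr]; exact SameRay.sameRay_nonneg_smul_right _ hr0)
      rw [hb]
  have hconv : Convex ℝ {x : Plane | Plane.area (g.dir b) (P b) ≤ Plane.area (g.dir b) x} := by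
    refine convex_halfSpace_ge (𝕜 := ℝ) ⟨fun x y => Plane.area_add_right _ x y, fun c x => ?_⟩ _
    rw [Plane.area_smul_right, smul_eq_mul]
  have := convexHull_min (s := range P) (by rintro _ ⟨c, rfl⟩; exact hmin c) hconv hx
  rw [Plane.area_sub_right]
  exact sub_nonneg.2 this

/-- The interiors of two polygons which have a common side with the same orientation meet. -/
theorem not_disjoint_interior (g h : D.Frame) {a : Fin (g.size + 3)} {b : Fin (h.size + 3)}
    (he : g.edge a = h.edge b) (hd : g.dir a = h.dir b) :
    ¬ Disjoint (interior g.polygon) (interior h.polygon) := by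
  have ha := g.isEdge a
  have hb := h.isEdge b
  rw [← he, ← hd] at hb
  have hu := ha.unit
  obtain ⟨l, hl, h1⟩ := ha.proj_eq
  obtain ⟨l', hl', h1'⟩ := hb.proj_eq
  have hp := ha.proj_tail_eq hb
  obtain ⟨r, hr, hr'⟩ := g.exists_left_mem_polygon a
  obtain ⟨s, hs, hs'⟩ := h.exists_left_mem_polygon b
  set p := D.proj (g.vertex a).1 with hpdef
  set d := g.dir a with hddef
  rw [← hd, ← hp] at hs'
  have hq : p + l • d ∈ g.polygon := h1 ▸ g.proj_mem_polygon (a + 1)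
  have hq' : p + l' • d ∈ h.polygon := by
    rw [hp, ← h1']; exact h.proj_mem_polygon (b + 1)
  have hl2 : l' = l := by
    have hq1 := ha.reverse.proj_tail_eq hb.reverse
    rw [h1, h1', ← hp, add_right_inj] at hq1
    have hd0 : d ≠ 0 := by rintro h0; rw [h0] at hu; norm_num at hu
    exact (smul_left_injective ℝ hd0 hq1).symm
  rw [hl2] at hq'
  obtain ⟨δ, hδ, hsub⟩ := Plane.exists_strip_subset (convex_convexHull ℝ _) hl hu
    (g.proj_mem_polygon a) hq hr hr'
  obtain ⟨ε, hε, hsub'⟩ := Plane.exists_strip_subset (convex_convexHull ℝ _) hl hu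
    (hp ▸ h.proj_mem_polygon b) hq' hs hs'
  -- Each polygon contains a strip to the left of the common segment; the thinner one is open,
  -- nonempty and contained in both.
  let U : Set Plane := {x | l / 4 < Plane.dot d (x - p) ∧ Plane.dot d (x - p) < 3 * l / 4 ∧
    0 < Plane.area d (x - p) ∧ Plane.area d (x - p) < min δ ε}
  have hU : IsOpen U := by
    have k1 : Continuous fun x : Plane => Plane.dot d (x - p) := by
      unfold Plane.dot; fun_prop
    have k2 : Continuous fun x : Plane => Plane.area d (x - p) := by
      unfold Plane.area; fun_prop
    exact (isOpen_lt continuous_const k1).inter ((isOpen_lt k1 continuous_const).inter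
      ((isOpen_lt continuous_const k2).inter (isOpen_lt k2 continuous_const)))
  have hUg : U ⊆ g.polygon := fun x hx =>
    hsub x hx.1 hx.2.1 hx.2.2.1 (hx.2.2.2.trans_le (min_le_left _ _))
  have hUh : U ⊆ h.polygon := fun x hx =>
    hsub' x hx.1 hx.2.1 hx.2.2.1 (hx.2.2.2.trans_le (min_le_right _ _))
  rw [not_disjoint_iff]
  have hm : 0 < min δ ε := lt_min hδ hε
  set m := min δ ε with hmdef
  let x : Plane := p + ((l / 2) • d + (m / 2) • ((-d.2, d.1) : Plane))
  have hx : x ∈ U := by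
    have e1 : Plane.dot d (x - p) = l / 2 := by
      simp only [x, add_sub_cancel_left, Plane.dot, Prod.fst_add, Prod.snd_add, Prod.smul_fst,
        Prod.smul_snd, smul_eq_mul]
      linear_combination l / 2 * hu
    have e2 : Plane.area d (x - p) = m / 2 := by
      simp only [x, add_sub_cancel_left, Plane.area, Prod.fst_add, Prod.snd_add, Prod.smul_fst,
        Prod.smul_snd, smul_eq_mul]
      linear_combination m / 2 * hu
    change _ < _ ∧ _ < _ ∧ _ < _ ∧ _ < _
    rw [e1, e2]
    refine ⟨by linarith, by linarith, by linarith, by linarith⟩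
  exact ⟨x, interior_maximal hUg hU hx, interior_maximal hUh hU hx⟩

end Frame

/-! ### Counting internal edges through pairs of glued sides -/

namespace Subdivision

variable {f : D.Frame} {k : ℕ}

/-- Two different pieces on the same side of an edge would overlap, and within one piece the
directions of the sides are distinct. -/
theorem eq_of_carrier_eq (S : Subdivision f k) {x y : Σ i, Fin ((S.piece i).size + 3)}
    (he : (S.piece x.1).edge x.2 = (S.piece y.1).edge y.2)
    (hd : (S.piece x.1).dir x.2 = (S.piece y.1).dir y.2) : x = y := by
  obtain ⟨i, a⟩ := x
  obtain ⟨j, b⟩ := y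
  have hij : i = j := by
    by_contra hij
    exact Frame.not_disjoint_interior _ _ he hd (S.disjoint_interior hij)
  subst hij
  have : a = b := (S.piece i).fan.distinct a b (by
    simp only at hd
    rw [hd])
  rw [this]

theorem isEdge_side (S : Subdivision f k) (x : Side f S.piece) :
    D.IsEdge x.carrier x.tail x.head x.dir := by
  cases x with
  | inl x => exact (S.piece x.1).isEdge x.2
  | inr a => exact (f.isEdge a).reverse

/-- The sides across which two pieces are glued. -/
def innerSides (S : Subdivision f k) : Set (Side f S.piece) :=
  {x | x.region ≠ none ∧ (S.twin x).region ≠ none}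

theorem twin_mem_innerSides {S : Subdivision f k} {x : Side f S.piece} (hx : x ∈ S.innerSides) :
    S.twin x ∈ S.innerSides :=
  ⟨hx.2, by rw [S.twin_twin]; exact hx.1⟩

theorem twin_ne (S : Subdivision f k) (x : Side f S.piece) : S.twin x ≠ x := by
  intro h
  have h1 := S.dir_twin x
  rw [h, self_eq_neg] at h1
  have h2 := (S.isEdge_side x).unit
  rw [h1] at h2
  norm_num at h2

theorem exists_inl {S : Subdivision f k} {x : Side f S.piece} (hx : x.region ≠ none) :
    ∃ y, x = .inl y := by
  cases x with
  | inl y => exact ⟨y, rfl⟩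
  | inr a => exact absurd rfl hx

/-- A critical edge has only two orientations, each used by at most one side of a piece. This makes
counting internal edges as subsets of `M` the same as counting glued pairs. -/
theorem eq_or_eq_twin_of_carrier_eq (S : Subdivision f k) {x y : Side f S.piece}
    (hx : x ∈ S.innerSides) (hy : y ∈ S.innerSides) (h : x.carrier = y.carrier) :
    y = x ∨ y = S.twin x := by
  have h1 := S.isEdge_side y
  rw [← h] at h1
  have key : ∀ {x y : Side f S.piece}, x ∈ S.innerSides → y ∈ S.innerSides →
      x.carrier = y.carrier → y.dir = x.dir → y = x := by
    intro x y hx hy h hd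
    obtain ⟨x, rfl⟩ := exists_inl hx.1
    obtain ⟨y, rfl⟩ := exists_inl hy.1
    exact congrArg Sum.inl (S.eq_of_carrier_eq h.symm hd)
  rcases (S.isEdge_side x).dir_eq_or h1 with h2 | h2
  · exact Or.inl (key hx hy h h2)
  · right
    refine key (twin_mem_innerSides hx) hy ?_ ?_
    · rw [S.carrier_twin, h]
    · rw [S.dir_twin, h2]

/-- An edge of the frame is not an inner edge of a subdivision. -/
theorem edge_ne_carrier (S : Subdivision f k) {x : Side f S.piece} (hx : x ∈ S.innerSides)
    (b : Fin (f.size + 3)) : f.edge b ≠ x.carrier := by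
  intro h
  obtain ⟨x, rfl⟩ := exists_inl hx.1
  have h1 := f.isEdge b
  have h2 := (S.piece x.1).isEdge x.2
  change f.edge b = (S.piece x.1).edge x.2 at h
  rw [← h] at h2
  -- With the orientation of `f`, the side would be the one glued to the outside. With the opposite
  -- orientation, its piece would have points to the right of a side of `f`, outside the polygon of
  -- `f`.
  rcases h1.dir_eq_or h2 with hd | hd
  · obtain ⟨y, hy⟩ := exists_inl (S.outer_glued b)
    have hc := S.carrier_twin (.inr b)
    have hdir := S.dir_twin (.inr b)
    rw [hy] at hc hdir
    change (S.piece y.1).edge y.2 = f.edge b at hc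
    change (S.piece y.1).dir y.2 = - -f.dir b at hdir
    rw [neg_neg] at hdir
    have hxy : x = y := S.eq_of_carrier_eq (h.symm.trans hc.symm) (hd.trans hdir.symm)
    subst hxy
    apply hx.2
    rw [← hy, S.twin_twin]
    rfl
  · obtain ⟨r, hr, hr'⟩ := (S.piece x.1).exists_left_mem_polygon x.2
    have hrf : r ∈ f.polygon := S.union_polygon ▸ mem_iUnion.2 ⟨x.1, hr⟩
    have h3 := f.area_nonneg_of_mem_polygon b hrf
    obtain ⟨l, hl, h4⟩ := h1.proj_eq
    have h5 : D.proj ((S.piece x.1).vertex x.2).1 = D.proj (f.vertex (b + 1)).1 := by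
      rw [hd] at h2
      exact h2.proj_tail_eq h1.reverse
    rw [hd, h5, h4, ← sub_sub, Plane.area_neg_left, Plane.area_sub_right, Plane.area_smul_right,
      Plane.area_self, mul_zero, sub_zero] at hr'
    linarith

/-- A map on a finite set whose fibers are the orbits of a fixed point free involution is
two-to-one. -/
theorem _root_.two_mul_ncard_image {α β : Type*} [Finite α] {I : Set α} {τ : α → α} {q : α → β}
    (hτ : ∀ x ∈ I, τ x ∈ I) (hne : ∀ x, τ x ≠ x)
    (hq : ∀ x ∈ I, ∀ y ∈ I, q x = q y ↔ y = x ∨ y = τ x) : 2 * (q '' I).ncard = I.ncard := by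
  classical
  have := Fintype.ofFinite α
  rw [Set.ncard_eq_toFinset_card' I]
  have h1 : q '' I = (I.toFinset.image q : Finset β) := by simp
  rw [h1, Set.ncard_coe_finset, Finset.card_eq_sum_card_image q I.toFinset,
    Finset.sum_congr rfl (g := fun _ => 2), Finset.sum_const, smul_eq_mul, mul_comm]
  intro b hb
  obtain ⟨x, hx, rfl⟩ := Finset.mem_image.1 hb
  rw [Set.mem_toFinset] at hx
  have : (I.toFinset.filter fun a => q a = q x) = {x, τ x} := by
    ext y
    simp only [Finset.mem_filter, Set.mem_toFinset, Finset.mem_insert, Finset.mem_singleton]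
    constructor
    · rintro ⟨hy, h⟩
      exact (hq x hx y hy).1 h.symm
    · rintro (rfl | rfl)
      · exact ⟨hx, rfl⟩
      · exact ⟨hτ x hx, ((hq x hx _ (hτ x hx)).2 (Or.inr rfl)).symm⟩
  rw [this, Finset.card_pair (hne x).symm]

theorem two_mul_ncard_internalEdges (S : Subdivision f k) :
    2 * S.internalEdges.ncard = S.innerSides.ncard := by
  have h : S.internalEdges = Side.carrier '' S.innerSides := by
    ext e
    constructor
    · rintro ⟨⟨i, a, rfl⟩, hne⟩
      refine ⟨.inl ⟨i, a⟩, ⟨by simp [Side.region], ?_⟩, rfl⟩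
      intro h
      cases h2 : S.twin (.inl ⟨i, a⟩) with
      | inl y => rw [h2] at h; cases h
      | inr b =>
        have h3 := S.carrier_twin (.inl ⟨i, a⟩)
        rw [h2] at h3
        exact hne b h3
    · rintro ⟨x, hx, rfl⟩
      refine ⟨?_, fun b => S.edge_ne_carrier hx b⟩
      obtain ⟨y, rfl⟩ := exists_inl hx.1
      exact ⟨y.1, y.2, rfl⟩
  rw [h]
  refine two_mul_ncard_image (τ := S.twin) (fun x hx => twin_mem_innerSides hx) S.twin_ne ?_
  intro x hx y hy
  refine ⟨S.eq_or_eq_twin_of_carrier_eq hx hy, ?_⟩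
  rintro (rfl | rfl)
  · rfl
  · rw [S.carrier_twin]

theorem two_mul_ncard_dualGraph_internalEdges (S : Subdivision f k) :
    2 * S.dualGraph.internalEdges.ncard = S.innerSides.ncard := by
  have h : S.dualGraph.internalEdges = (fun x => s(x, S.twin x)) '' S.innerSides := by
    ext e
    constructor
    · rintro ⟨x, rfl, h1, h2⟩
      exact ⟨x, ⟨h1, h2⟩, rfl⟩
    · rintro ⟨x, ⟨h1, h2⟩, rfl⟩
      exact ⟨x, rfl, h1, h2⟩
  rw [h]
  refine two_mul_ncard_image (τ := S.twin) (fun x hx => twin_mem_innerSides hx) S.twin_ne ?_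
  intro x hx y hy
  refine (Sym2.eq_iff (α := Side f S.piece)).trans ?_
  constructor
  · rintro (⟨h, -⟩ | ⟨-, h⟩)
    · exact Or.inl h.symm
    · exact Or.inr h.symm
  · rintro (rfl | rfl)
    · exact Or.inl ⟨rfl, rfl⟩
    · exact Or.inr ⟨(S.twin_twin x).symm, rfl⟩

/-- Each side of a piece is either inner or the twin of a unique outer side, and outer sides
correspond to the edges of `f`. -/
theorem ncard_innerSides (S : Subdivision f k) : (S.innerSides.ncard : ℤ) =
    ∑ i, (((S.piece i).size + 3 : ℕ) : ℤ) - (f.size + 3 : ℕ) := by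
  have h1 : (range (Sum.inl : _ → Side f S.piece)) =
      S.innerSides ∪ range fun a => S.twin (.inr a) := by
    ext x
    constructor
    · rintro ⟨y, rfl⟩
      cases h2 : S.twin (.inl y) with
      | inl z => exact Or.inl ⟨by simp [Side.region], by simp [h2, Side.region]⟩
      | inr b => exact Or.inr ⟨b, by simp only; rw [← h2, S.twin_twin]⟩
    · rintro (hx | ⟨b, rfl⟩)
      · obtain ⟨y, rfl⟩ := exists_inl hx.1
        exact mem_range_self y
      · obtain ⟨y, hy⟩ := exists_inl (S.outer_glued b)
        exact ⟨y, hy.symm⟩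
  have h2 : Disjoint S.innerSides (range fun a => S.twin (.inr a)) := by
    rw [Set.disjoint_right]
    rintro _ ⟨b, rfl⟩ hx
    apply hx.2
    rw [S.twin_twin]
    rfl
  have h3 := Set.ncard_union_eq h2
  have hinj : Function.Injective S.twin := fun x y h => by
    rw [← S.twin_twin x, h, S.twin_twin]
  have hinj' : Function.Injective fun a => S.twin (.inr a) := hinj.comp Sum.inr_injective
  rw [← h1, ← Set.image_univ, Set.ncard_image_of_injective _ Sum.inl_injective, Set.ncard_univ,
    ← Set.image_univ, Set.ncard_image_of_injective _ hinj', Set.ncard_univ,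
    Nat.card_eq_fintype_card, Nat.card_eq_fintype_card, Fintype.card_sigma] at h3
  simp only [Fintype.card_fin] at h3
  rw [← Nat.cast_sum, h3]
  push_cast
  ring

end Subdivision

end TwoMorse

end Frames

theorem lemma5p10 {n : ℕ} {M : Type*} [TopologicalSpace M] [T2Space M] [CompactSpace M]
    [ChartedSpace (EuclideanSpace ℝ (Fin n)) M] [IsManifold (𝓡 n) ∞ M]
    (D : TwoMorse n M) (f : D.Frame) {k : ℕ} (S : TwoMorse.Subdivision f k) :
    S.expectedCodim = S.dualGraph.expectedDim ∧
      S.expectedCodim = 2 * (k : ℤ) - (S.internalEdges.ncard : ℤ) - 2 := by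
  have h1 := S.two_mul_expectedCodim
  have h2 := S.two_mul_ncard_internalEdges
  have h3 := S.two_mul_ncard_dualGraph_internalEdges
  have h4 := S.ncard_innerSides
  rw [← h4] at h1
  have h5 : (Nat.card S.dualGraph.V : ℤ) = k := by
    change (Nat.card (Fin k) : ℤ) = k
    rw [Nat.card_fin]
  rw [GraphWithDirections.expectedDim, h5]
  -- The doubled codimension is `4 * (k - 1)` minus the number of inner sides, and that number is
  -- twice either edge count.
  constructor <;> omega
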